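/- Let $k$ be an algebraically closed field of characteristic $0$ and let $X\subset\mathbb P_n$ be an arithmetically Cohen–Macaulay (ACM) projective subscheme of dimension $m\ge 1$, with saturated homogeneous ideal $I_X\subset S=k[X_0,\dots,X_n]$ and projecting ring $A_X=S/I_X$; ACM means that $\dim A_X=m+1$ and that $A_X$ admits a regular sequence of $m+1$ homogeneous polynomials. Assume that $X$ is (arithmetically) Gorenstein, i.e. that the ring $A_X$ is Gorenstein (of finite injective dimension over itself). Let $Y,Y'\subset X$ be ACM hypersurfaces of $X$, i.e. ACM subschemes of dimension $m-1$ contained in $X$, and suppose that they are linked in the section $X\cap H$ of $X$ by a hypersurface $H=\{h=0\}$, where $h$ is a homogeneous polynomial of degree $s$. This means that, with $I_{X\cap H}=I_X+(h)$, one has $I_{X\cap H}\subset I_Y\cap I_{Y'}$ and $I_YI_{Y'}\subset I_{X\cap H}$, and that multiplication induces an isomorphism $I_{Y'}\to \mathrm{Hom}_S(I_Y,I_{X\cap H})$. For linear forms $Y_0,\dots,Y_m$ forming a regular sequence on $A_X$ put $R_m=k[Y_0,\dots,Y_m]$ and $I_{Y/X}=I_Y/I_X$, $I_{Y'/X}=I_{Y'}/I_X$.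 The characteristic sequence of $X$ is the nondecreasing sequence $m_0\le\dots\le m_{d-1}$ such that $A_X\simeq\bigoplus_{i=0}^{d-1}R_m[-m_i]$ as a graded $R_m$-module; the characteristic sequences of $Y$ and $Y'$ relative to $X$ are the nondecreasing sequences $(n_i)_{0\le i\le d-1}$ and $(n'_i)_{0\le i\le d-1}$ such that $I_{Y/X}\simeq\bigoplus_{i=0}^{d-1} R_m[-n_i]$ and $I_{Y'/X}\simeq\bigoplus_{i=0}^{d-1} R_m[-n'_i]$ as graded $R_m$-modules, where each of the three sequences may be computed with its own choice of $Y_0,\dots,Y_m$. Then such sequences exist, with a common length $d$, and for any such sequences $$n_i+n'_{d-1-i}=m_{d-1}+s\qquad(0\le i\le d-1).$$ -/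

import Mathlib

namespace ProjACM

open MvPolynomial

attribute [local instance] MvPolynomial.gradedAlgebra

variable {k : Type*} [Field k] {n : ℕ}

/-- `I` defines an arithmetically Cohen-Macaulay projective subscheme of dimension `m` of `ℙⁿ`:
`I` is homogeneous, the projecting ring `A = k[X₀, …, Xₙ] / I` has Krull dimension `m + 1`, and
there is an `A`-regular sequence of `m + 1` homogeneous polynomials. (Such an ideal is
automatically saturated and unmixed.) -/
structure IsACM (m : ℕ) (I : Ideal (MvPolynomial (Fin (n + 1)) k)) : Prop where
  homogeneous : I.IsHomogeneous (homogeneousSubmodule (Fin (n + 1)) k)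
  krullDim_eq : ringKrullDim (MvPolynomial (Fin (n + 1)) k ⧸ I) = (m + 1 : ℕ)
  exists_regular : ∃ rs : List (MvPolynomial (Fin (n + 1)) k), rs.length = m + 1 ∧
    (∀ r ∈ rs, ∃ e, r.IsHomogeneous e) ∧
    RingTheory.Sequence.IsRegular (MvPolynomial (Fin (n + 1)) k ⧸ I) rs

/-- The (Noetherian, finite dimensional) ring `A = k[X₀, …, Xₙ] / I` is Gorenstein:
it has finite injective dimension as a module over itself. -/
def IsGorenstein (I : Ideal (MvPolynomial (Fin (n + 1)) k)) : Prop :=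
  ∃ N : ℕ, CategoryTheory.HasInjectiveDimensionLE
    (ModuleCat.of (MvPolynomial (Fin (n + 1)) k ⧸ I) (MvPolynomial (Fin (n + 1)) k ⧸ I)) N

/-- `y₀, …, yₘ` is a sequence of linear forms which is regular on `A_X = k[X₀, …, Xₙ] / IX`. -/
structure IsRegularLinearSystem (IX : Ideal (MvPolynomial (Fin (n + 1)) k)) {m : ℕ}
    (y : Fin (m + 1) → MvPolynomial (Fin (n + 1)) k) : Prop where
  linear : ∀ i, (y i).IsHomogeneous 1
  regular : RingTheory.Sequence.IsRegular (MvPolynomial (Fin (n + 1)) k ⧸ IX) (List.ofFn y)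

/-- Let `J` be an ideal of `A_X = k[X₀, …, Xₙ] / IX` and `R = k[y₀, …, yₘ]`. Then
`J ≅ ⨁ᵢ R[-eᵢ]` as a graded `R`-module: `J` has an `R`-basis of homogeneous elements,
of degrees `e₀, …, e_{d-1}`. -/
def HasHomogeneousBasis {IX : Ideal (MvPolynomial (Fin (n + 1)) k)} {m : ℕ}
    (y : Fin (m + 1) → MvPolynomial (Fin (n + 1)) k)
    (J : Ideal (MvPolynomial (Fin (n + 1)) k ⧸ IX)) {d : ℕ} (e : Fin d → ℕ) : Prop :=
  ∃ b : Module.Basis (Fin d) (Algebra.adjoin k (Set.range y)) J,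
    ∀ i, ∃ f : MvPolynomial (Fin (n + 1)) k, f.IsHomogeneous (e i) ∧
      Ideal.Quotient.mk IX f = (b i : MvPolynomial (Fin (n + 1)) k ⧸ IX)

/-- `e₀ ≤ … ≤ e_{d-1}` is the (absolute) characteristic sequence of the subscheme `X` of
dimension `m` with ideal `IX`. -/
def IsCharSeq (m : ℕ) (IX : Ideal (MvPolynomial (Fin (n + 1)) k)) {d : ℕ} (e : Fin d → ℕ) : Prop :=
  Monotone e ∧ ∃ y : Fin (m + 1) → MvPolynomial (Fin (n + 1)) k,
    IsRegularLinearSystem IX y ∧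
      HasHomogeneousBasis y (⊤ : Ideal (MvPolynomial (Fin (n + 1)) k ⧸ IX)) e

/-- `e₀ ≤ … ≤ e_{d-1}` is the characteristic sequence relative to `X` (of dimension `m`, with
ideal `IX`) of the subscheme `Y` of `X` with ideal `IY`; here `I_{Y/X} = IY / IX` is the ideal
of `Y` in `A_X`. -/
def IsRelCharSeq (m : ℕ) (IX IY : Ideal (MvPolynomial (Fin (n + 1)) k)) {d : ℕ}
    (e : Fin d → ℕ) : Prop :=
  Monotone e ∧ ∃ y : Fin (m + 1) → MvPolynomial (Fin (n + 1)) k,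
    IsRegularLinearSystem IX y ∧
      HasHomogeneousBasis y (IY.map (Ideal.Quotient.mk IX)) e

/-- If `I * J ≤ K`, the `A`-linear map `J → Hom_A(I, K)`, `f ↦ (g ↦ g f)`. -/
def linkMap {A : Type*} [CommRing A] (I J K : Ideal A) (hmul : I * J ≤ K) : J →ₗ[A] (I →ₗ[A] K) :=
  LinearMap.mk₂ A (fun f g => ⟨(g : A) * (f : A), hmul (Ideal.mul_mem_mul g.2 f.2)⟩)
    (fun _ _ _ => Subtype.ext (mul_add _ _ _))
    (fun _ _ _ => Subtype.ext (mul_left_comm _ _ _))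
    (fun _ _ _ => Subtype.ext (add_mul _ _ _))
    (fun _ _ _ => Subtype.ext (mul_assoc _ _ _))

/-- The subschemes with ideals `I` and `J` are linked in the subscheme `Z` with ideal `K`
(the second is the residual of the first in `Z`): both are contained in `Z`, and multiplication
induces an isomorphism `J ≅ Hom(I, K)`. -/
structure AreLinked {A : Type*} [CommRing A] (I J K : Ideal A) : Prop where
  left_le : K ≤ I
  right_le : K ≤ J
  mul_le : I * J ≤ K
  bijective : Function.Bijective (linkMap I J K mul_le)

end ProjACM

/-! Write `A = S / I_X`, let `y₀, …, yₘ` be linear forms regular on `A`, and put `R = k[y₀, …, yₘ]`,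
so that `A` is free over `R`. The theorem is a duality: `I_{Y'/X}` is the `R`-dual of `I_{Y/X}`,
twisted by `c + s` with `c = m_{d-1}`. A homogeneous basis of degrees `n_i` has a dual basis of
degrees `c + s - n_i`, and sorting reverses the order.

The duality rests on a perfect pairing `A × A → R` of degree `-c`. For `Q = (y)`, the long exact
sequences of multiplication by each `y_i` show that `Ext^{m+1}_A(A/Q, A)` is cyclic with generator
of annihilator inside `Q`, and that the higher groups vanish. If the socle of `A/Q` contained two
independent copies of the residue field `κ`, finite injective dimension and dévissage would make
`Ext^{m+1}(κ², A)` a quotient of this cyclic module; a square of a `κ`-vector space is cyclic only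
if it is zero, and then `Ext^{m+1}(A/Q, A)` would vanish too (`exists_mul_add_mul_mem`). So the
socle is a line, spanned by the basis element of top degree `c`. The coordinate `φ` along that
element pairs `A/Q` with itself without kernel; its Gram determinant over `R` is homogeneous with
nonzero constant term, hence a unit (`IsRelBasis.isPerfectForm`).

Linkage says that `I_{Y'} = (I_X + (h)) : I_Y`, and it forces `h` to be a nonzerodivisor on `A`. An
element `w` of `I_{Y'}` gives the form `x ↦ φ(wx/h)` on `I_{Y/X}`, and perfection of `φ` makes this
correspondence bijective (`IsRelBasis.exists_dual`).

The degrees of a homogeneous basis are read off from a Hilbert function, which does not see the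
chosen linear forms (`IsRelBasis.sigma_eq`); this allows three different choices of `y`. For
existence, avoidance over an infinite field gives linear forms adapted to `X` and `Y` at once. The
lengths agree because `I_Y` contains a nonzerodivisor of `A`, so `I_{Y/X}` has the rank of `A`. -/

namespace ProjACM

open CategoryTheory CategoryTheory.Abelian

universe u

/-! ### `Ext` into the ring and the socle of a Gorenstein ring modulo a regular sequence. -/

section ExtSelf

variable {A : Type u} [CommRing A]

/-- `Ext_A^i(M, A)`. -/
abbrev ExtSelf (A : Type u) [CommRing A] (M : Type u) [AddCommGroup M] [Module A M] (i : ℕ) :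
    Type u :=
  Ext.{u} (ModuleCat.of A M) (ModuleCat.of A A) i

namespace ExtSelf

variable {M N P : Type u} [AddCommGroup M] [Module A M] [AddCommGroup N] [Module A N]
  [AddCommGroup P] [Module A P]

/-- The contravariant functoriality of `Ext_A^i(-, A)`. -/
noncomputable def pull (f : M →ₗ[A] N) {i : ℕ} (x : ExtSelf A N i) : ExtSelf A M i :=
  (Ext.mk₀ (ModuleCat.ofHom f)).comp x (zero_add i)

variable {i : ℕ}

lemma pull_comp (f : M →ₗ[A] N) (g : N →ₗ[A] P) (x : ExtSelf A P i) :
    pull (g ∘ₗ f) x = pull f (pull g x) := by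
  simp [pull, ModuleCat.ofHom_comp]

lemma pull_id (x : ExtSelf A M i) : pull LinearMap.id x = x := by
  simp [pull]

lemma pull_zero (x : ExtSelf A N i) : pull (0 : M →ₗ[A] N) x = 0 := by
  have : ModuleCat.ofHom (0 : M →ₗ[A] N) = 0 := rfl
  simp [pull, this]

lemma pull_smul_left (a : A) (f : M →ₗ[A] N) (x : ExtSelf A N i) :
    pull (a • f) x = a • pull f x := by
  have : ModuleCat.ofHom (a • f) = a • ModuleCat.ofHom f := rfl
  rw [pull, this, Ext.mk₀_smul, Ext.smul_comp, pull]

lemma pull_smul (a : A) (f : M →ₗ[A] N) (x : ExtSelf A N i) :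
    pull f (a • x) = a • pull f x := by
  simp [pull]

lemma smul_eq_pull (a : A) (x : ExtSelf A M i) : a • x = pull (a • LinearMap.id) x := by
  rw [pull_smul_left, pull_id]

lemma pull_apply_zero (f : M →ₗ[A] N) : pull f (0 : ExtSelf A N i) = 0 := by
  simp [pull]

lemma subsingleton_of_equiv (e : M ≃ₗ[A] N) (h : Subsingleton (ExtSelf A M i)) :
    Subsingleton (ExtSelf A N i) := by
  refine ⟨fun x y => ?_⟩
  have hx : ∀ z : ExtSelf A N i, z = pull e.symm.toLinearMap (pull e.toLinearMap z) := fun z => by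
    rw [← pull_comp]
    simp [pull_id]
  rw [hx x, hx y, Subsingleton.elim (pull e.toLinearMap x) (pull e.toLinearMap y)]

lemma shortExact {f : M →ₗ[A] N} {g : N →ₗ[A] P} (hf : Function.Injective f)
    (hfg : Function.Exact f g) (hg : Function.Surjective g) :
    (ShortComplex.mk (ModuleCat.ofHom f) (ModuleCat.ofHom g)
      (by ext x; exact hfg.apply_apply_eq_zero x)).ShortExact where
  exact := by
    rw [ShortComplex.ShortExact.moduleCat_exact_iff_function_exact]
    exact hfg
  mono_f := (ModuleCat.mono_iff_injective _).2 hf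
  epi_g := (ModuleCat.epi_iff_surjective _).2 hg

lemma exists_pull_eq {f : M →ₗ[A] N} {g : N →ₗ[A] P} (hf : Function.Injective f)
    (hfg : Function.Exact f g) (hg : Function.Surjective g) (x : ExtSelf A N i)
    (hx : pull f x = 0) : ∃ z : ExtSelf A P i, pull g z = x :=
  Ext.contravariant_sequence_exact₂ (shortExact hf hfg hg) _ x hx

/-- The long exact sequence of `Ext_A^i(-, A)` around the connecting map. -/
lemma exists_connecting {f : M →ₗ[A] N} {g : N →ₗ[A] P} (hf : Function.Injective f)
    (hfg : Function.Exact f g) (hg : Function.Surjective g) (i : ℕ) :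
    ∃ δ : ExtSelf A M i →ₗ[A] ExtSelf A P (i + 1),
      (∀ x, pull g x = 0 → ∃ z, δ z = x) ∧ (∀ z, δ z = 0 → ∃ x, pull f x = z) := by
  have S := shortExact hf hfg hg
  refine ⟨{ toFun := fun x => S.extClass.comp x (add_comm 1 i)
            map_add' := fun x y => by simp
            map_smul' := fun a x => by simp }, fun x hx => ?_, fun z hz => ?_⟩
  · exact Ext.contravariant_sequence_exact₃ S _ x hx (add_comm 1 i)
  · exact Ext.contravariant_sequence_exact₁ S _ z (add_comm 1 i) hz

lemma subsingleton_of_exact {f : M →ₗ[A] N} {g : N →ₗ[A] P} (hf : Function.Injective f)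
    (hfg : Function.Exact f g) (hg : Function.Surjective g) (hM : Subsingleton (ExtSelf A M i))
    (hP : Subsingleton (ExtSelf A P i)) : Subsingleton (ExtSelf A N i) := by
  refine subsingleton_of_forall_eq 0 fun x => ?_
  obtain ⟨z, rfl⟩ := exists_pull_eq hf hfg hg x (Subsingleton.elim _ _)
  rw [Subsingleton.elim z 0, pull_apply_zero]

/-- `Ext_A^i(A/I, A)` vanishes for `i > p`, and is cyclic, with a generator of annihilator
contained in `I`, for `i = p`. -/
structure CyclicTop (I : Ideal A) (p : ℕ) : Prop where
  vanish : ∀ i, p < i → Subsingleton (ExtSelf A (A ⧸ I) i)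
  cyclic : ∃ e : ExtSelf A (A ⧸ I) p, (∀ x, ∃ a : A, x = a • e) ∧ ∀ a : A, a • e = 0 → a ∈ I

lemma cyclicTop_bot : CyclicTop (⊥ : Ideal A) 0 := by
  let φ : (A ⧸ (⊥ : Ideal A)) ≃ₗ[A] A := Submodule.quotEquivOfEqBot ⊥ rfl
  constructor
  · intro i hi
    refine subsingleton_of_equiv φ.symm ?_
    obtain ⟨j, rfl⟩ : ∃ j, i = j + 1 := ⟨i - 1, by omega⟩
    have : Projective (ModuleCat.of A A) := ModuleCat.projective_of_free (Module.Basis.singleton Unit A)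
    exact subsingleton_of_forall_eq 0 Ext.eq_zero_of_projective
  · refine ⟨Ext.mk₀ (ModuleCat.ofHom φ.toLinearMap), fun x => ?_, fun a ha => ?_⟩
    · obtain ⟨f, rfl⟩ := (Ext.mk₀_bijective _ _).2 x
      refine ⟨f (φ.symm 1), ?_⟩
      rw [← Ext.mk₀_smul]
      congr 1
      refine ModuleCat.hom_ext (LinearMap.ext fun y => ?_)
      obtain ⟨y, rfl⟩ := φ.symm.surjective y
      have h1 : φ.symm y = y • φ.symm 1 := by rw [← map_smul, smul_eq_mul, mul_one]
      have h2 : f (φ.symm y) = y • f (φ.symm 1) := by rw [h1]; exact map_smul f.hom _ _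
      have h3 : (f (φ.symm 1) • ModuleCat.ofHom φ.toLinearMap) (φ.symm y) =
        f (φ.symm 1) • φ (φ.symm y) := rfl
      refine h2.trans (Eq.trans ?_ h3.symm)
      rw [φ.apply_symm_apply, smul_eq_mul, smul_eq_mul, mul_comm]
    · rw [← Ext.mk₀_smul, Ext.mk₀_eq_zero_iff] at ha
      have h3 : (a • ModuleCat.ofHom φ.toLinearMap) (φ.symm 1) = a • φ (φ.symm 1) := rfl
      rw [ha, φ.apply_symm_apply, smul_eq_mul, mul_one] at h3
      exact h3.symm

/-- From `0 → A/I → A/I → A/(I + (r)) → 0`, the connecting map `δ` sends `Ext^p(A/I, A)` onto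
`Ext^{p+1}(A/(I + (r)), A)`, since `Ext^{p+1}(A/I, A) = 0`; thus `δ e` is a generator. Its
annihilator is controlled by the kernel of `δ`, which is the image of multiplication by `r`. -/
lemma CyclicTop.step {I : Ideal A} {p : ℕ} (h : CyclicTop I p) {r : A}
    (hr : ∀ u, r * u ∈ I → u ∈ I) : CyclicTop (I ⊔ Ideal.span {r}) (p + 1) := by
  let f : (A ⧸ I) →ₗ[A] (A ⧸ I) := r • LinearMap.id
  let g : (A ⧸ I) →ₗ[A] (A ⧸ (I ⊔ Ideal.span {r})) := Submodule.factor le_sup_left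
  have hf : Function.Injective f := by
    rw [injective_iff_map_eq_zero]
    intro x hx
    obtain ⟨x, rfl⟩ := Ideal.Quotient.mk_surjective x
    exact Ideal.Quotient.eq_zero_iff_mem.2 (hr x (Ideal.Quotient.eq_zero_iff_mem.1 hx))
  have hg : Function.Surjective g := Submodule.factor_surjective _
  have hfg : Function.Exact f g := by
    intro x
    constructor
    · intro hx
      obtain ⟨x, rfl⟩ := Ideal.Quotient.mk_surjective x
      have hx' : x ∈ I ⊔ Ideal.span {r} := Ideal.Quotient.eq_zero_iff_mem.1 hx
      obtain ⟨y, hy, z, hz, rfl⟩ := Submodule.mem_sup.1 hx'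
      obtain ⟨w, rfl⟩ := Ideal.mem_span_singleton'.1 hz
      refine ⟨Ideal.Quotient.mk I w, ?_⟩
      change Ideal.Quotient.mk I (r * w) = _
      rw [Ideal.Quotient.eq]
      have : r * w - (y + w * r) = -y := by ring
      rw [this]
      exact I.neg_mem hy
    · rintro ⟨w, rfl⟩
      obtain ⟨w, rfl⟩ := Ideal.Quotient.mk_surjective w
      change Ideal.Quotient.mk (I ⊔ Ideal.span {r}) (r * w) = 0
      rw [Ideal.Quotient.eq_zero_iff_mem]
      exact (Ideal.mul_mem_right _ _ (le_sup_right (a := I) (Ideal.mem_span_singleton_self r)))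
  constructor
  · intro i hi
    obtain ⟨j, rfl⟩ : ∃ j, i = j + 1 := ⟨i - 1, by omega⟩
    have := h.vanish j (by omega)
    have := h.vanish (j + 1) (by omega)
    obtain ⟨δ, hδ, -⟩ := exists_connecting hf hfg hg j
    refine subsingleton_of_forall_eq 0 fun x => ?_
    obtain ⟨z, rfl⟩ := hδ x (Subsingleton.elim _ _)
    rw [Subsingleton.elim z 0, map_zero]
  · obtain ⟨e, he, he'⟩ := h.cyclic
    have := h.vanish (p + 1) (by omega)
    obtain ⟨δ, hδ, hδ'⟩ := exists_connecting hf hfg hg p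
    refine ⟨δ e, fun x => ?_, fun a ha => ?_⟩
    · obtain ⟨z, rfl⟩ := hδ x (Subsingleton.elim _ _)
      obtain ⟨a, rfl⟩ := he z
      exact ⟨a, map_smul δ a e⟩
    · rw [← map_smul] at ha
      obtain ⟨w, hw⟩ := hδ' _ ha
      obtain ⟨b, rfl⟩ := he w
      rw [pull_smul_left, pull_id, smul_smul] at hw
      have := he' (a - r * b) (by rw [sub_smul, hw, sub_self])
      have h2 : a = (a - r * b) + r * b := by ring
      rw [h2]
      exact Ideal.add_mem _ (le_sup_left (a := I) this)
        (Ideal.mul_mem_right _ _ (le_sup_right (a := I) (Ideal.mem_span_singleton_self r)))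

/-- Dévissage: if `Ext_A^i(A/𝔪, A) = 0` then `Ext_A^i(M, A) = 0` for all `M` of finite length whose
composition factors are isomorphic to `A/𝔪`. -/
lemma subsingleton_of_isFiniteLength {𝔪 Q : Ideal A} (hQ : ∀ 𝔫 : Ideal A, 𝔫.IsMaximal → Q ≤ 𝔫 → 𝔫 = 𝔪)
    (h𝔪 : Subsingleton (ExtSelf A (A ⧸ 𝔪) i)) (hM : IsFiniteLength A M)
    (hQM : ∀ a ∈ Q, ∀ x : M, a • x = 0) : Subsingleton (ExtSelf A M i) := by
  induction hM with
  | @of_subsingleton M _ _ _ =>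
    refine subsingleton_of_forall_eq 0 fun x => ?_
    rw [← pull_id x, show (LinearMap.id : M →ₗ[A] M) = 0 from Subsingleton.elim _ _, pull_zero]
  | @of_simple_quotient M _ _ N hS _ ih =>
    refine subsingleton_of_exact (f := N.subtype) (g := N.mkQ) N.injective_subtype
      (LinearMap.exact_subtype_mkQ N) N.mkQ_surjective
      (ih fun a ha x => Subtype.ext (hQM a ha x)) ?_
    obtain ⟨𝔫, h𝔫, ⟨e⟩⟩ := isSimpleModule_iff_quot_maximal.1 hS
    -- `Q` kills `M`, hence its simple quotient `A/𝔫`.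
    have : Q ≤ 𝔫 := by
      intro a ha
      rw [← Ideal.Quotient.eq_zero_iff_mem]
      obtain ⟨x, hx⟩ := e.surjective 1
      obtain ⟨x, rfl⟩ := N.mkQ_surjective x
      have h1 : Ideal.Quotient.mk 𝔫 a = a • (1 : A ⧸ 𝔫) := by
        rw [Algebra.smul_def, mul_one]; rfl
      rw [h1, ← hx, ← map_smul, ← map_smul, hQM a ha]
      simp
    obtain rfl := hQ 𝔫 h𝔫 this
    exact subsingleton_of_equiv e.symm h𝔪

end ExtSelf

open ExtSelf

/-- Descending induction on `i`, starting above the injective dimension. If `Ext^{i+1}(A/𝔪, A) = 0`,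
dévissage kills `Ext^{i+1}` of the cokernel of `f`, so `Ext^i(A/Q, A) = 0` surjects onto `Ext^i(A/𝔪,
A)`. -/
lemma subsingleton_extSelf_residueField {N p : ℕ}
    [hN : HasInjectiveDimensionLE (ModuleCat.of A A) N]
    {𝔪 Q : Ideal A} (hQ : ∀ 𝔫 : Ideal A, 𝔫.IsMaximal → Q ≤ 𝔫 → 𝔫 = 𝔪)
    (hfl : IsFiniteLength A (A ⧸ Q)) (htop : CyclicTop Q p) {f : (A ⧸ 𝔪) →ₗ[A] (A ⧸ Q)}
    (hf : Function.Injective f) (i : ℕ) (hi : p < i) : Subsingleton (ExtSelf A (A ⧸ 𝔪) i) := by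
  -- Here `j` bounds the number of steps from `i` up to the range where injective dimension gives
  -- the vanishing.
  suffices H : ∀ j i, p < i → N < i + j → Subsingleton (ExtSelf A (A ⧸ 𝔪) i) from
    H (N + 1) i hi (by omega)
  intro j
  induction j with
  | zero =>
    intro i _ hi
    exact HasInjectiveDimensionLT.subsingleton (ModuleCat.of A A) (N + 1) i hi _
  | succ j ih =>
    intro i hpi hi
    have h1 := ih (i + 1) (by omega) (by omega)
    have h2 := htop.vanish i hpi
    let g := (LinearMap.range f).mkQ
    have hg : Function.Surjective g := Submodule.mkQ_surjective _
    have h3 : Subsingleton (ExtSelf A ((A ⧸ Q) ⧸ LinearMap.range f) (i + 1)) := by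
      refine subsingleton_of_isFiniteLength hQ h1 (hfl.of_surjective hg) fun a ha x => ?_
      obtain ⟨x, rfl⟩ := hg x
      obtain ⟨x, rfl⟩ := Ideal.Quotient.mk_surjective x
      have : a • Ideal.Quotient.mk Q x = 0 :=
        Ideal.Quotient.eq_zero_iff_mem.2 (Q.mul_mem_right _ ha)
      rw [← map_smul, this, map_zero]
    obtain ⟨δ, -, hδ⟩ := exists_connecting hf (LinearMap.exact_map_mkQ_range f) hg i
    refine subsingleton_of_forall_eq 0 fun x => ?_
    obtain ⟨w, rfl⟩ := hδ x (Subsingleton.elim _ _)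
    rw [Subsingleton.elim w 0, pull_apply_zero]

/-- If `A` has finite injective dimension and `Q` is generated by a regular sequence, then the socle
of `A/Q` has dimension at most one. -/
theorem exists_mul_add_mul_mem {N p : ℕ} (hN : HasInjectiveDimensionLE (ModuleCat.of A A) N)
    {𝔪 Q : Ideal A} [h𝔪 : 𝔪.IsMaximal] (hQ : ∀ 𝔫 : Ideal A, 𝔫.IsMaximal → Q ≤ 𝔫 → 𝔫 = 𝔪)
    (hQ1 : Q ≠ ⊤) (hfl : IsFiniteLength A (A ⧸ Q)) (htop : CyclicTop Q p) {u v : A}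
    (hu : ∀ x ∈ 𝔪, x * u ∈ Q) (hv : ∀ x ∈ 𝔪, x * v ∈ Q) :
    ∃ a b : A, (a ∉ 𝔪 ∨ b ∉ 𝔪) ∧ a * u + b * v ∈ Q := by
  by_contra! hcon
  have hmul : ∀ w : A, (∀ x ∈ 𝔪, x * w ∈ Q) →
      ∃ f : (A ⧸ 𝔪) →ₗ[A] (A ⧸ Q), ∀ a, f (Ideal.Quotient.mk 𝔪 a) = Ideal.Quotient.mk Q (a * w) := by
    intro w hw
    refine ⟨Submodule.liftQ 𝔪 (LinearMap.toSpanSingleton A _ (Ideal.Quotient.mk Q w)) ?_, fun a => rfl⟩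
    intro x hx
    exact Ideal.Quotient.eq_zero_iff_mem.2 (hw x hx)
  obtain ⟨fu, hfu⟩ := hmul u hu
  obtain ⟨fv, hfv⟩ := hmul v hv
  have hfu_inj : Function.Injective fu := by
    rw [injective_iff_map_eq_zero]
    intro x hx
    obtain ⟨x, rfl⟩ := Ideal.Quotient.mk_surjective x
    rw [hfu, Ideal.Quotient.eq_zero_iff_mem] at hx
    by_contra hne
    rw [Ideal.Quotient.eq_zero_iff_mem] at hne
    exact hcon x 0 (Or.inl hne) (by simpa using hx)
  -- The negated conclusion says exactly that `u` and `v` span a copy of `(A/𝔪)²` inside `A/Q`.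
  let F : ((A ⧸ 𝔪) × (A ⧸ 𝔪)) →ₗ[A] (A ⧸ Q) := fu.coprod fv
  have hF : Function.Injective F := by
    rw [injective_iff_map_eq_zero]
    rintro ⟨x, y⟩ hx
    obtain ⟨x, rfl⟩ := Ideal.Quotient.mk_surjective x
    obtain ⟨y, rfl⟩ := Ideal.Quotient.mk_surjective y
    rw [LinearMap.coprod_apply, hfu, hfv, ← map_add, Ideal.Quotient.eq_zero_iff_mem] at hx
    have h1 : x ∈ 𝔪 := by
      by_contra h; exact hcon x y (Or.inl h) hx
    have h2 : y ∈ 𝔪 := by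
      by_contra h; exact hcon x y (Or.inr h) hx
    rw [Ideal.Quotient.eq_zero_iff_mem.2 h1, Ideal.Quotient.eq_zero_iff_mem.2 h2]
    rfl
  have hker : ∀ a ∈ 𝔪, ∀ {i : ℕ} (x : ExtSelf A (A ⧸ 𝔪) i), a • x = 0 := by
    intro a ha i x
    have : (a • LinearMap.id : (A ⧸ 𝔪) →ₗ[A] (A ⧸ 𝔪)) = 0 := by
      ext
      exact Ideal.Quotient.eq_zero_iff_mem.2 (𝔪.mul_mem_right _ ha)
    rw [smul_eq_pull, this, pull_zero]
  obtain ⟨e, he, he'⟩ := htop.cyclic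
  -- The cokernel of `F` has no `Ext^{p+1}`, so the cyclic module `Ext^p(A/Q, A)` surjects onto
  -- `Ext^p((A/𝔪)², A)`.
  have hsurj : ∀ x : ExtSelf A ((A ⧸ 𝔪) × (A ⧸ 𝔪)) p, ∃ a : A, x = a • pull F e := by
    intro x
    let g := (LinearMap.range F).mkQ
    have hg : Function.Surjective g := Submodule.mkQ_surjective _
    have h1 := subsingleton_extSelf_residueField (N := N) hQ hfl htop hfu_inj (p + 1) (by omega)
    have h3 : Subsingleton (ExtSelf A ((A ⧸ Q) ⧸ LinearMap.range F) (p + 1)) := by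
      refine subsingleton_of_isFiniteLength hQ h1 (hfl.of_surjective hg) fun a ha x => ?_
      obtain ⟨x, rfl⟩ := hg x
      obtain ⟨x, rfl⟩ := Ideal.Quotient.mk_surjective x
      have : a • Ideal.Quotient.mk Q x = 0 :=
        Ideal.Quotient.eq_zero_iff_mem.2 (Q.mul_mem_right _ ha)
      rw [← map_smul, this, map_zero]
    obtain ⟨δ, -, hδ⟩ := exists_connecting hF (LinearMap.exact_map_mkQ_range F) hg p
    obtain ⟨w, rfl⟩ := hδ x (Subsingleton.elim _ _)
    obtain ⟨a, rfl⟩ := he w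
    exact ⟨a, pull_smul a F e⟩
  -- With `(e₁, e₂)` the components of the generator, write `(ε, 0) = a(e₁, e₂)` and `(0, ε) = b(e₁,
  -- e₂)`. If `a ∈ 𝔪` then `ε = a e₁ = 0`; otherwise `a` is invertible modulo `𝔪`, so `a e₂ = 0`
  -- gives `e₂ = 0` and `ε = b e₂ = 0`.
  have hzero : Subsingleton (ExtSelf A (A ⧸ 𝔪) p) := by
    refine subsingleton_of_forall_eq 0 fun ε => ?_
    obtain ⟨a, ha⟩ := hsurj (pull (LinearMap.fst A _ _) ε)
    obtain ⟨b, hb⟩ := hsurj (pull (LinearMap.snd A _ _) ε)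
    have h1 : ε = a • pull (LinearMap.inl A _ _) (pull F e) := by
      rw [← pull_smul, ← ha, ← pull_comp, LinearMap.fst_comp_inl, pull_id]
    have h2 : 0 = a • pull (LinearMap.inr A _ _) (pull F e) := by
      rw [← pull_smul, ← ha, ← pull_comp, LinearMap.fst_comp_inr, pull_zero]
    have h3 : ε = b • pull (LinearMap.inr A _ _) (pull F e) := by
      rw [← pull_smul, ← hb, ← pull_comp, LinearMap.snd_comp_inr, pull_id]
    by_cases ham : a ∈ 𝔪
    · rw [h1, hker a ham]
    · obtain ⟨c, z, hz, hc⟩ := Ideal.IsMaximal.exists_inv h𝔪 ham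
      rw [h3, ← one_smul A (pull (LinearMap.inr A _ _) (pull F e)), ← hc, add_smul, hker z hz,
        add_zero, mul_smul, ← h2, smul_zero, smul_zero]
  -- By dévissage `Ext^p(A/Q, A)` vanishes, so `1` kills its generator and lies in `Q`.
  have hzero' : Subsingleton (ExtSelf A (A ⧸ Q) p) := by
    refine subsingleton_of_isFiniteLength hQ hzero hfl fun a ha x => ?_
    obtain ⟨x, rfl⟩ := Ideal.Quotient.mk_surjective x
    exact Ideal.Quotient.eq_zero_iff_mem.2 (Q.mul_mem_right _ ha)
  exact hQ1 ((Ideal.eq_top_iff_one Q).2 (he' 1 (Subsingleton.elim _ _)))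

end ExtSelf

end ProjACM

namespace ProjACM

open CategoryTheory CategoryTheory.Abelian

/-! ### Regular sequences on a quotient `L / N` of ideals. -/

section RegOn

variable {S : Type*} [CommRing S]

/-- For ideals `N ≤ L`, the sequence `ys` is weakly regular on `L / N`. -/
def RegOn (L : Ideal S) : Ideal S → List S → Prop
  | _, [] => True
  | N, y :: ys => (∀ u ∈ L, y * u ∈ N → u ∈ N) ∧ RegOn L (N ⊔ Ideal.span {y} * L) ys

lemma regOn_top_cons {N : Ideal S} {y : S} {ys : List S} :
    RegOn ⊤ N (y :: ys) ↔ (∀ u, y * u ∈ N → u ∈ N) ∧ RegOn ⊤ (N ⊔ Ideal.span {y}) ys := by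
  simp [RegOn]

lemma regOn_top_iff_isWeaklyRegular {I : Ideal S} {ys : List S} :
    RegOn ⊤ I ys ↔ RingTheory.Sequence.IsWeaklyRegular (S ⧸ I) ys := by
  induction ys generalizing I with
  | nil => simp [RegOn]
  | cons y ys ih =>
    rw [regOn_top_cons, RingTheory.Sequence.isWeaklyRegular_cons_iff, ih]
    refine and_congr ?_ ?_
    · constructor
      · intro h
        rw [isSMulRegular_iff_right_eq_zero_of_smul]
        intro x hx
        obtain ⟨x, rfl⟩ := Ideal.Quotient.mk_surjective x
        exact Ideal.Quotient.eq_zero_iff_mem.2 (h x (Ideal.Quotient.eq_zero_iff_mem.1 hx))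
      · intro h u hu
        rw [isSMulRegular_iff_right_eq_zero_of_smul] at h
        exact Ideal.Quotient.eq_zero_iff_mem.1 (h (Ideal.Quotient.mk I u)
          (Ideal.Quotient.eq_zero_iff_mem.2 hu))
    · refine LinearEquiv.isWeaklyRegular_congr ?_ ys
      refine (Submodule.quotientQuotientEquivQuotientSup I (Ideal.span {y})).symm ≪≫ₗ
        Submodule.quotEquivOfEq _ _ ?_
      ext x
      constructor
      · rintro ⟨z, hz, rfl⟩
        obtain ⟨w, rfl⟩ := Ideal.mem_span_singleton.1 hz
        exact ⟨Ideal.Quotient.mk I w, trivial, rfl⟩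
      · rintro ⟨z, -, rfl⟩
        obtain ⟨z, rfl⟩ := Ideal.Quotient.mk_surjective z
        exact ⟨y * z, Ideal.mul_mem_right _ _ (Ideal.mem_span_singleton_self y), rfl⟩

lemma isRegular_quotient_iff {I : Ideal S} {ys : List S} :
    RingTheory.Sequence.IsRegular (S ⧸ I) ys ↔ RegOn ⊤ I ys ∧ I ⊔ Ideal.ofList ys ≠ ⊤ := by
  rw [RingTheory.Sequence.isRegular_iff, regOn_top_iff_isWeaklyRegular]
  refine and_congr Iff.rfl (not_congr ?_)
  have h : (Ideal.ofList ys • ⊤ : Submodule S (S ⧸ I)) =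
      Submodule.map (Submodule.mkQ I) (Ideal.ofList ys) := by
    rw [← I.range_mkQ, ← Submodule.map_top, ← Submodule.map_smul'']
    simp
  rw [h]
  constructor
  · intro h
    have h1 : Ideal.Quotient.mk I 1 ∈ Submodule.map (Submodule.mkQ I) (Ideal.ofList ys) := h ▸ trivial
    obtain ⟨x, hx, hx1⟩ := h1
    rw [Ideal.eq_top_iff_one]
    have h2 : 1 - x ∈ I := Ideal.Quotient.eq.1 hx1.symm
    have h3 : (1 : S) = (1 - x) + x := by ring
    rw [h3]
    exact Submodule.add_mem_sup h2 hx
  · intro h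
    rw [eq_comm, eq_top_iff]
    rintro x -
    obtain ⟨x, rfl⟩ := Ideal.Quotient.mk_surjective x
    obtain ⟨a, ha, b, hb, rfl⟩ := Submodule.mem_sup.1 (h ▸ trivial : x ∈ I ⊔ Ideal.ofList ys)
    refine ⟨b, hb, ?_⟩
    change Ideal.Quotient.mk I b = _
    rw [Ideal.Quotient.eq]
    have : b - (a + b) = -a := by ring
    rw [this]
    exact I.neg_mem ha

/-- If `ys, y` is regular on `S/I` and `ys` is regular on `S/(I + L)`, then `ys, y` is regular on
`L/(I ∩ L)`. -/
lemma RegOn.inf {I L : Ideal S} {ys : List S} {y : S} (h1 : RegOn ⊤ I (ys ++ [y]))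
    (h2 : RegOn ⊤ (I ⊔ L) ys) : RegOn L (I ⊓ L) (ys ++ [y]) := by
  induction ys generalizing I with
  | nil =>
    rw [List.nil_append] at h1 ⊢
    exact ⟨fun u hu h => ⟨(regOn_top_cons.1 h1).1 u h.1, hu⟩, trivial⟩
  | cons z ys ih =>
    rw [List.cons_append, regOn_top_cons] at h1
    rw [regOn_top_cons] at h2
    rw [List.cons_append]
    refine ⟨fun u hu h => ⟨h1.1 u h.1, hu⟩, ?_⟩
    -- If `i + z a ∈ L` then `z a ∈ I + L`; regularity of `z` on `S/(I + L)` gives `a = j + l`, and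
    -- `i + z j` lies in `I ∩ L`. This identity lets the induction replace `I` by `I + (z)`.
    have : I ⊓ L ⊔ Ideal.span {z} * L = (I ⊔ Ideal.span {z}) ⊓ L := by
      apply le_antisymm
      · exact sup_le (inf_le_inf_right _ le_sup_left)
          (le_inf (Ideal.mul_le_left.trans le_sup_right : Ideal.span {z} * L ≤ _) Ideal.mul_le_right)
      · rintro x ⟨hx, hxL⟩
        obtain ⟨i, hi, w, hw, rfl⟩ := Submodule.mem_sup.1 hx
        obtain ⟨a, rfl⟩ := Ideal.mem_span_singleton.1 hw
        have ha : z * a ∈ I ⊔ L := by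
          have : z * a = -i + (i + z * a) := by ring
          rw [this]
          exact Submodule.add_mem_sup (I.neg_mem hi) hxL
        obtain ⟨j, hj, l, hl, rfl⟩ := Submodule.mem_sup.1 (h2.1 a ha)
        have h3 : z * l ∈ L := L.mul_mem_left z hl
        have h4 : i + z * (j + l) = (i + z * j) + z * l := by ring
        rw [h4] at hxL ⊢
        refine Submodule.add_mem_sup ⟨I.add_mem hi (I.mul_mem_left z hj), ?_⟩
          (Ideal.mul_mem_mul (Ideal.mem_span_singleton_self z) hl)
        exact (L.add_mem_iff_left h3).1 hxL
    rw [this]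
    refine ih h1.2 ?_
    rw [sup_right_comm]
    exact h2.2

lemma RegOn.map_quotient {I₀ I : Ideal S} (hI : I₀ ≤ I) {ys : List S} (h : RegOn ⊤ I ys) :
    RegOn ⊤ (I.map (Ideal.Quotient.mk I₀)) (ys.map (Ideal.Quotient.mk I₀)) := by
  induction ys generalizing I with
  | nil => trivial
  | cons y ys ih =>
    rw [regOn_top_cons] at h
    rw [List.map_cons, regOn_top_cons]
    refine ⟨fun u hu => ?_, ?_⟩
    · obtain ⟨u, rfl⟩ := Ideal.Quotient.mk_surjective u
      rw [← map_mul] at hu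
      exact (Ideal.mem_quotient_iff_mem hI).2 (h.1 u ((Ideal.mem_quotient_iff_mem hI).1 hu))
    · have := ih (hI.trans le_sup_left) h.2
      rwa [Ideal.map_sup, Ideal.map_span, Set.image_singleton] at this

lemma ExtSelf.CyclicTop.of_regOn {A : Type*} [CommRing A] {I : Ideal A} {p : ℕ} {ys : List A}
    (hI : ExtSelf.CyclicTop I p) (h : RegOn ⊤ I ys) :
    ExtSelf.CyclicTop (I ⊔ Ideal.ofList ys) (p + ys.length) := by
  induction ys generalizing I p with
  | nil => simpa using hI
  | cons y ys ih =>
    rw [regOn_top_cons] at h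
    have := ih (hI.step h.1) h.2
    rw [Ideal.ofList_cons, ← sup_assoc, List.length_cons, add_comm ys.length, ← add_assoc]
    exact this

end RegOn

/-! ### Exchanging elements of regular sequences. -/

section Depth

variable {S : Type*} [CommRing S]

/-- The ideal `𝔪` is not associated to `S/I`. -/
def NotAssoc (𝔪 I : Ideal S) : Prop := ∀ u, (∀ w ∈ 𝔪, w * u ∈ I) → u ∈ I

lemma NotAssoc.of_regular {𝔪 I : Ideal S} {r : S} (hr : r ∈ 𝔪) (h : ∀ u, r * u ∈ I → u ∈ I) :
    NotAssoc 𝔪 I := fun u hu => h u (hu r hr)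

/-- The relation `r u ≡ y v` modulo `I` matches the elements killed by `𝔪` in `S/(I + (y))` with
those in `S/(I + (r))`: if `v ≡ r v'`, cancelling `r` gives `u ≡ y v'`. -/
lemma NotAssoc.exchange {𝔪 I : Ideal S} {r y : S} (hrm : r ∈ 𝔪) (hr : ∀ u, r * u ∈ I → u ∈ I)
    (hy : ∀ u, y * u ∈ I → u ∈ I) (h : NotAssoc 𝔪 (I ⊔ Ideal.span {r})) :
    NotAssoc 𝔪 (I ⊔ Ideal.span {y}) := by
  have key : ∀ {a b : S}, a ∈ I ⊔ Ideal.span {b} ↔ ∃ c, a - b * c ∈ I := by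
    intro a b
    rw [Submodule.mem_sup]
    constructor
    · rintro ⟨i, hi, z, hz, rfl⟩
      obtain ⟨c, rfl⟩ := Ideal.mem_span_singleton.1 hz
      exact ⟨c, by simpa using hi⟩
    · rintro ⟨c, hc⟩
      exact ⟨_, hc, b * c, Ideal.mul_mem_right _ _ (Ideal.mem_span_singleton_self b), by ring⟩
  intro u hu
  obtain ⟨v, hv⟩ := key.1 (hu r hrm)
  have hv' : v ∈ I ⊔ Ideal.span {r} := by
    refine h v fun z hz => ?_
    obtain ⟨w, hw⟩ := key.1 (hu z hz)
    refine key.2 ⟨w, hy _ ?_⟩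
    have : y * (z * v - r * w) = r * (z * u - y * w) - z * (r * u - y * v) := by ring
    rw [this]
    exact I.sub_mem (I.mul_mem_left _ hw) (I.mul_mem_left _ hv)
  obtain ⟨v', hv'⟩ := key.1 hv'
  refine key.2 ⟨v', hr _ ?_⟩
  have : r * (u - y * v') = (r * u - y * v) + y * (v - r * v') := by ring
  rw [this]
  exact I.add_mem hv (I.mul_mem_left _ hv')

/-- The half of the permutability of a regular sequence `r, z` that needs no local or graded
hypothesis. -/
lemma regular_swap {I : Ideal S} {r z : S}
    (hzr : ∀ u, z * u ∈ I ⊔ Ideal.span {r} → u ∈ I ⊔ Ideal.span {r})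
    (hr : ∀ u, r * u ∈ I → u ∈ I) (u : S) (hu : r * u ∈ I ⊔ Ideal.span {z}) :
    u ∈ I ⊔ Ideal.span {z} := by
  obtain ⟨i, hi, t, ht, h⟩ := Submodule.mem_sup.1 hu
  obtain ⟨w, rfl⟩ := Ideal.mem_span_singleton.1 ht
  have h1 : z * w ∈ I ⊔ Ideal.span {r} := by
    have : z * w = -i + r * u := by rw [← h]; ring
    rw [this]
    exact Submodule.add_mem_sup (I.neg_mem hi)
      (Ideal.mul_mem_right _ _ (Ideal.mem_span_singleton_self r))
  obtain ⟨j, hj, t, ht, h2⟩ := Submodule.mem_sup.1 (hzr w h1)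
  obtain ⟨w', rfl⟩ := Ideal.mem_span_singleton.1 ht
  have h3 : u - z * w' ∈ I := by
    refine hr _ ?_
    have : r * (u - z * w') = i + z * j := by
      have : r * (u - z * w') = r * u - z * (r * w') := by ring
      rw [this, ← h, ← h2]; ring
    rw [this]
    exact I.add_mem hi (I.mul_mem_left _ hj)
  have h4 : u = (u - z * w') + z * w' := by ring
  rw [h4]
  exact Submodule.add_mem_sup h3 (Ideal.mul_mem_right _ _ (Ideal.mem_span_singleton_self z))

/-- Any element of `𝔪` which is regular on `S/I` decreases the depth by at most one, provided that
there are enough regular elements. -/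
lemma RegOn.exists_tail {𝔪 : Ideal S}
    (havoid : ∀ I J : Ideal S, NotAssoc 𝔪 I → NotAssoc 𝔪 J → ∃ z ∈ 𝔪,
      (∀ u, z * u ∈ I → u ∈ I) ∧ (∀ u, z * u ∈ J → u ∈ J))
    {p : ℕ} {I : Ideal S} {rs : List S} (hrs : RegOn ⊤ I rs) (hlen : rs.length = p + 1)
    (hmem : ∀ r ∈ rs, r ∈ 𝔪) {y : S} (hym : y ∈ 𝔪) (hy : ∀ u, y * u ∈ I → u ∈ I) :
    ∃ ts : List S, ts.length = p ∧ (∀ r ∈ ts, r ∈ 𝔪) ∧ RegOn ⊤ (I ⊔ Ideal.span {y}) ts := by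
  induction p generalizing I rs y with
  | zero => exact ⟨[], rfl, by simp, trivial⟩
  | succ p ih =>
    match rs, hrs, hlen, hmem with
    | r :: r2 :: rest, hrs, hlen, hmem =>
      rw [regOn_top_cons] at hrs
      have hrm : r ∈ 𝔪 := hmem r (by simp)
      have h2 : NotAssoc 𝔪 (I ⊔ Ideal.span {r}) :=
        .of_regular (hmem r2 (by simp)) (regOn_top_cons.1 hrs.2).1
      have h3 : NotAssoc 𝔪 (I ⊔ Ideal.span {y}) := h2.exchange hrm hrs.1 hy
      -- The element `z` mediates between `r` and `y`. Induction over `I + (r)` gives a sequence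
      -- after `z`; swapping, `r` followed by it is regular over `I + (z)`. Induction over `I + (z)`
      -- then trades `r` for `y`, and a last swap puts `z` after `y`.
      obtain ⟨z, hzm, hz2, hz3⟩ := havoid _ _ h2 h3
      obtain ⟨rs1, hl1, hm1, hr1⟩ := ih hrs.2 (by simpa using hlen)
        (fun t ht => hmem t (List.mem_cons_of_mem _ ht)) hzm hz2
      have h4 : RegOn ⊤ (I ⊔ Ideal.span {z}) (r :: rs1) := by
        rw [regOn_top_cons]
        refine ⟨regular_swap hz2 hrs.1, ?_⟩
        rwa [sup_right_comm]
      obtain ⟨rs2, hl2, hm2, hr2⟩ := ih h4 (by simpa using hl1)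
        (by simpa using ⟨hrm, hm1⟩) hym (regular_swap hz3 hy)
      refine ⟨z :: rs2, by simpa using hl2, by simpa using ⟨hzm, hm2⟩, ?_⟩
      rw [regOn_top_cons]
      refine ⟨hz3, ?_⟩
      rwa [sup_right_comm]

end Depth

end ProjACM

namespace ProjACM

open MvPolynomial

/-! ### Generic linear forms, and finiteness modulo a maximal regular sequence. -/

section Polynomial

variable {σ k : Type*} [Field k]

lemma mem_idealOfVars_iff {f : MvPolynomial σ k} : f ∈ idealOfVars σ k ↔ constantCoeff f = 0 := by
  have := mem_pow_idealOfVars_iff' 1 f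
  rw [pow_one] at this
  rw [this]
  constructor
  · intro h; exact h 0 (by simp)
  · intro h x hx
    have : x = 0 := by
      rw [← Finsupp.degree_eq_zero_iff]; omega
    rw [this]; exact h

lemma idealOfVars_ne_top : idealOfVars σ k ≠ ⊤ := by
  rw [Ne, Ideal.eq_top_iff_one, mem_idealOfVars_iff]
  simp

lemma idealOfVars_eq_ker : idealOfVars σ k = RingHom.ker (constantCoeff (σ := σ) (R := k)) := by
  ext f
  rw [mem_idealOfVars_iff, RingHom.mem_ker]

instance idealOfVars_isMaximal : (idealOfVars σ k).IsMaximal := by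
  rw [idealOfVars_eq_ker]
  refine RingHom.ker_isMaximal_of_surjective _ fun c => ⟨C c, constantCoeff_C σ c⟩

lemma mem_idealOfVars_of_isHomogeneous {f : MvPolynomial σ k} {e : ℕ} (hf : f.IsHomogeneous e)
    (he : e ≠ 0) : f ∈ idealOfVars σ k := by
  rw [mem_idealOfVars_iff, constantCoeff_eq]
  exact hf.coeff_eq_zero (by simpa using he.symm)

/-- The linear forms inside an associated prime of `S/I` or `S/J` form a proper subspace, since
otherwise the prime would contain all variables. A vector space over an infinite field is not a
finite union of proper subspaces. -/
lemma exists_isHomogeneous_one_regular [Finite σ] [Infinite k] {I J : Ideal (MvPolynomial σ k)}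
    (hI : NotAssoc (idealOfVars σ k) I) (hJ : NotAssoc (idealOfVars σ k) J) :
    ∃ z : MvPolynomial σ k, z.IsHomogeneous 1 ∧ (∀ u, z * u ∈ I → u ∈ I) ∧
      (∀ u, z * u ∈ J → u ∈ J) := by
  let V := homogeneousSubmodule σ k 1
  let W : Ideal (MvPolynomial σ k) → Submodule k V := fun P =>
    (P.restrictScalars k).comap V.subtype
  have hass : ∀ I : Ideal (MvPolynomial σ k), NotAssoc (idealOfVars σ k) I →
      ∀ P ∈ associatedPrimes (MvPolynomial σ k) (MvPolynomial σ k ⧸ I), W P ≠ ⊤ := by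
    intro I hI P hP htop
    obtain ⟨hprime, x, rfl⟩ := isAssociatedPrime_iff.1 hP
    obtain ⟨u, rfl⟩ := Ideal.Quotient.mk_surjective x
    have hle : idealOfVars σ k ≤ Submodule.colon ⊥ {Ideal.Quotient.mk I u} := by
      rw [idealOfVars, Ideal.span_le]
      rintro _ ⟨i, rfl⟩
      have : (⟨X i, isHomogeneous_X k i⟩ : V) ∈ W (Submodule.colon ⊥ {Ideal.Quotient.mk I u}) := by
        rw [htop]; trivial
      exact this
    have hu : u ∈ I := by
      refine hI u fun w hw => ?_
      have := hle hw
      rw [Submodule.mem_colon_singleton, Submodule.mem_bot] at this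
      exact Ideal.Quotient.eq_zero_iff_mem.1 this
    apply hprime.ne_top
    rw [Ideal.Quotient.eq_zero_iff_mem.2 hu]
    simp
  have hfI := (associatedPrimes.finite (MvPolynomial σ k) (MvPolynomial σ k ⧸ I)).image W
  have hfJ := (associatedPrimes.finite (MvPolynomial σ k) (MvPolynomial σ k ⧸ J)).image W
  have hfin := hfI.union hfJ
  have htop : ⊤ ∉ hfin.toFinset := by
    rw [Set.Finite.mem_toFinset]
    rintro (⟨P, hP, h⟩ | ⟨P, hP, h⟩)
    · exact hass I hI P hP h
    · exact hass J hJ P hP h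
  obtain ⟨z, hz⟩ := (Set.ne_univ_iff_exists_notMem _).1 (Subspace.biUnion_ne_univ_of_top_notMem htop)
  simp only [Set.mem_iUnion, not_exists, Set.Finite.mem_toFinset] at hz
  have hreg : ∀ I : Ideal (MvPolynomial σ k),
      (∀ P ∈ associatedPrimes (MvPolynomial σ k) (MvPolynomial σ k ⧸ I), z ∉ W P) →
      ∀ u, (z : MvPolynomial σ k) * u ∈ I → u ∈ I := by
    intro I h u hu
    by_contra hne
    have : (z : MvPolynomial σ k) ∈ { r : MvPolynomial σ k |
        ∃ x : MvPolynomial σ k ⧸ I, x ≠ 0 ∧ r • x = 0 } :=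
      ⟨Ideal.Quotient.mk I u, fun h => hne (Ideal.Quotient.eq_zero_iff_mem.1 h),
        Ideal.Quotient.eq_zero_iff_mem.2 hu⟩
    rw [← biUnion_associatedPrimes_eq_zero_divisors] at this
    simp only [Set.mem_iUnion] at this
    obtain ⟨P, hP, hz⟩ := this
    exact h P hP hz
  refine ⟨z, z.2, hreg I fun P hP h => ?_, hreg J fun P hP h => ?_⟩
  · exact hz _ (Or.inl ⟨P, hP, rfl⟩) h
  · exact hz _ (Or.inr ⟨P, hP, rfl⟩) h

/-- The given sequences only certify depth. Each new linear form is taken regular on both quotients,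
and `RegOn.exists_tail` shows that the depths drop by no more than one. The extra form `y` is
regular on the first quotient only. -/
lemma exists_linear_regOn [Finite σ] [Infinite k] {p : ℕ} {I J : Ideal (MvPolynomial σ k)}
    {rs ts : List (MvPolynomial σ k)} (hrs : RegOn ⊤ I rs) (hrl : rs.length = p + 1)
    (hrm : ∀ r ∈ rs, r ∈ idealOfVars σ k) (hts : RegOn ⊤ J ts) (htl : ts.length = p)
    (htm : ∀ r ∈ ts, r ∈ idealOfVars σ k) :
    ∃ (ys : List (MvPolynomial σ k)) (y : MvPolynomial σ k), ys.length = p ∧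
      (∀ z ∈ ys, z.IsHomogeneous 1) ∧ y.IsHomogeneous 1 ∧ RegOn ⊤ I (ys ++ [y]) ∧
      RegOn ⊤ J ys := by
  have havoid : ∀ I J : Ideal (MvPolynomial σ k), NotAssoc (idealOfVars σ k) I →
      NotAssoc (idealOfVars σ k) J → ∃ z ∈ idealOfVars σ k,
        (∀ u, z * u ∈ I → u ∈ I) ∧ (∀ u, z * u ∈ J → u ∈ J) := by
    intro I J hI hJ
    obtain ⟨z, hz, h⟩ := exists_isHomogeneous_one_regular hI hJ
    exact ⟨z, mem_idealOfVars_of_isHomogeneous hz one_ne_zero, h⟩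
  induction p generalizing I J rs ts with
  | zero =>
    match rs, hrs, hrl, hrm with
    | r :: rs, hrs, _, hrm =>
      have h1 := NotAssoc.of_regular (hrm r (by simp)) (regOn_top_cons.1 hrs).1
      obtain ⟨y, hy, hyI, -⟩ := exists_isHomogeneous_one_regular h1 h1
      exact ⟨[], y, rfl, by simp, hy, regOn_top_cons.2 ⟨hyI, trivial⟩, trivial⟩
  | succ p ih =>
    match rs, hrs, hrl, hrm, ts, hts, htl, htm with
    | r :: rs, hrs, hrl, hrm, t :: ts, hts, htl, htm =>
      have h1 := NotAssoc.of_regular (hrm r (by simp)) (regOn_top_cons.1 hrs).1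
      have h2 := NotAssoc.of_regular (htm t (by simp)) (regOn_top_cons.1 hts).1
      obtain ⟨z, hz, hzI, hzJ⟩ := exists_isHomogeneous_one_regular h1 h2
      have hzm := mem_idealOfVars_of_isHomogeneous hz one_ne_zero
      obtain ⟨rs', hl1, hm1, hr1⟩ := hrs.exists_tail havoid hrl hrm hzm hzI
      obtain ⟨ts', hl2, hm2, hr2⟩ := hts.exists_tail havoid htl htm hzm hzJ
      obtain ⟨ys, y, hl, hlin, hy, hregI, hregJ⟩ := ih hr1 hl1 hm1 hr2 hl2 hm2
      refine ⟨z :: ys, y, by simpa using hl, by simpa using ⟨hz, hlin⟩, hy, ?_, ?_⟩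
      · rw [List.cons_append, regOn_top_cons]
        exact ⟨hzI, hregI⟩
      · rw [regOn_top_cons]
        exact ⟨hzJ, hregJ⟩

lemma RegOn.ringKrullDim_add_le {S : Type*} [CommRing S] {I : Ideal S} {ys : List S}
    (h : RegOn ⊤ I ys) :
    ringKrullDim (S ⧸ (I ⊔ Ideal.ofList ys)) + ys.length ≤ ringKrullDim (S ⧸ I) := by
  induction ys generalizing I with
  | nil =>
    rw [Ideal.ofList_nil, sup_bot_eq]
    simp
  | cons y ys ih =>
    rw [regOn_top_cons] at h
    have h1 := ih h.2
    have h2 : ringKrullDim (S ⧸ (I ⊔ Ideal.span {y})) + 1 ≤ ringKrullDim (S ⧸ I) := by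
      refine ringKrullDim_succ_le_of_surjective (Ideal.Quotient.factor le_sup_left)
        (Ideal.Quotient.factor_surjective _) (r := Ideal.Quotient.mk I y) ?_ ?_
      · rw [mem_nonZeroDivisors_iff_left]
        intro x hx
        obtain ⟨x, rfl⟩ := Ideal.Quotient.mk_surjective x
        rw [← map_mul, Ideal.Quotient.eq_zero_iff_mem] at hx
        exact Ideal.Quotient.eq_zero_iff_mem.2 (h.1 x hx)
      · rw [Ideal.Quotient.factor_mk, Ideal.Quotient.eq_zero_iff_mem]
        exact le_sup_right (a := I) (Ideal.mem_span_singleton_self y)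
    rw [Ideal.ofList_cons, ← sup_assoc, List.length_cons]
    push_cast
    rw [← add_assoc]
    exact (add_le_add_left h1 1).trans h2

/-- Each regular element lowers the dimension by at least one, so the quotient has dimension at most
zero, and a finitely generated `k`-algebra of that kind is finite over `k`. -/
lemma RegOn.finite_quotient [Finite σ] {I : Ideal (MvPolynomial σ k)} {ys : List (MvPolynomial σ k)}
    (h : RegOn ⊤ I ys) (hdim : ringKrullDim (MvPolynomial σ k ⧸ I) = (ys.length : ℕ)) :
    Module.Finite k (MvPolynomial σ k ⧸ (I ⊔ Ideal.ofList ys)) := by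
  rw [Module.finite_iff_krullDimLE_zero, Ring.krullDimLE_iff]
  have h1 := h.ringKrullDim_add_le
  rw [hdim] at h1
  generalize ringKrullDim (MvPolynomial σ k ⧸ (I ⊔ Ideal.ofList ys)) = d at h1 ⊢
  induction d with
  | bot => simp
  | coe d =>
    induction d with
    | top =>
      exfalso
      revert h1
      exact not_le_of_gt (WithBot.coe_lt_coe.2 (by simp))
    | coe d =>
      have : ((d + ys.length : ℕ) : WithBot ℕ∞) ≤ (ys.length : ℕ) := by exact_mod_cast h1
      have := Nat.cast_le.1 this
      have : d = 0 := by omega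
      subst this
      simp

end Polynomial

lemma le_idealOfVars_of_isHomogeneous {σ k : Type*} [Field k] {I : Ideal (MvPolynomial σ k)}
    (hI : ∀ f ∈ I, ∀ t, homogeneousComponent t f ∈ I) (h1 : I ≠ ⊤) : I ≤ idealOfVars σ k := by
  intro f hf
  rw [mem_idealOfVars_iff]
  by_contra hne
  apply h1
  have := hI f hf 0
  rw [homogeneousComponent_zero] at this
  refine Ideal.eq_top_of_isUnit_mem I this ?_
  exact (isUnit_iff_ne_zero.2 hne).map C

section ACM

variable {k : Type*} [Field k] {n m : ℕ} {I : Ideal (MvPolynomial (Fin (n + 1)) k)}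

attribute [local instance] MvPolynomial.gradedAlgebra

lemma IsACM.homogeneousComponent_mem (h : IsACM m I) : ∀ f ∈ I, ∀ t, homogeneousComponent t f ∈ I :=
  fun _ hf t => MvPolynomial.homogeneousComponent_mem_of_mem h.homogeneous hf t

lemma IsACM.exists_regOn (h : IsACM m I) : ∃ rs : List (MvPolynomial (Fin (n + 1)) k),
    rs.length = m + 1 ∧ RegOn ⊤ I rs ∧ ∀ r ∈ rs, r ∈ idealOfVars (Fin (n + 1)) k := by
  obtain ⟨rs, hl, hhom, hreg⟩ := h.exists_regular
  rw [isRegular_quotient_iff] at hreg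
  refine ⟨rs, hl, hreg.1, fun r hr => ?_⟩
  obtain ⟨e, he⟩ := hhom r hr
  -- An element of degree zero is a constant; a nonzero one would generate the unit ideal, against
  -- regularity.
  by_cases he0 : e = 0
  · subst he0
    rw [mem_idealOfVars_iff]
    by_contra hne
    apply hreg.2
    refine Ideal.eq_top_of_isUnit_mem _
      (le_sup_right (a := I) (Ideal.subset_span hr : r ∈ Ideal.ofList rs)) ?_
    have : r = C (constantCoeff r) := by
      have h0 := homogeneousComponent_zero r
      rw [homogeneousComponent_eq_self he] at h0
      exact h0
    rw [this]
    exact (isUnit_iff_ne_zero.2 hne).map C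
  · exact mem_idealOfVars_of_isHomogeneous he he0

lemma IsACM.ne_top (h : IsACM m I) : I ≠ ⊤ := by
  rintro rfl
  have := h.krullDim_eq
  rw [ringKrullDim_eq_bot_of_subsingleton] at this
  exact WithBot.natCast_ne_bot (m + 1) this.symm

end ACM

end ProjACM

namespace ProjACM

open MvPolynomial

/-! ### Homogeneous components of products and of polynomials in linear forms. -/

section HomogeneousComponent

variable {σ k : Type*} [Field k]

lemma homogeneousComponent_mul_of_isHomogeneous {f g : MvPolynomial σ k} {e : ℕ}
    (hg : g.IsHomogeneous e) (t : ℕ) :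
    homogeneousComponent t (f * g) = if e ≤ t then homogeneousComponent (t - e) f * g else 0 := by
  conv_lhs => rw [← sum_homogeneousComponent f, Finset.sum_mul, map_sum]
  have h : ∀ i, homogeneousComponent t (homogeneousComponent i f * g) =
      if t = i + e then homogeneousComponent i f * g else 0 := fun i =>
    homogeneousComponent_of_mem ((homogeneousComponent_isHomogeneous i f).mul hg)
  simp_rw [h]
  split_ifs with het
  · have h2 : ∀ i, (t = i + e) ↔ (t - e = i) := fun i => by omega
    simp_rw [h2]
    rw [Finset.sum_ite_eq]
    split_ifs with hm
    · rfl
    · rw [Finset.mem_range, not_lt] at hm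
      rw [homogeneousComponent_eq_zero _ _ (by omega), zero_mul]
  · refine Finset.sum_eq_zero fun i _ => if_neg (by omega)

lemma homogeneousComponent_aeval {τ : Type*} {y : τ → MvPolynomial σ k}
    (hy : ∀ i, (y i).IsHomogeneous 1) (f : MvPolynomial τ k) (t : ℕ) :
    homogeneousComponent t (aeval y f) = aeval y (homogeneousComponent t f) := by
  conv_lhs => rw [← sum_homogeneousComponent f, map_sum, map_sum]
  have h : ∀ i, homogeneousComponent t (aeval y (homogeneousComponent i f)) =
      if t = i then aeval y (homogeneousComponent i f) else 0 := fun i => by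
    have := (homogeneousComponent_isHomogeneous i f).aeval y hy
    rw [one_mul] at this
    exact homogeneousComponent_of_mem this
  simp_rw [h]
  rw [Finset.sum_ite_eq]
  split_ifs with hm
  · rfl
  · rw [Finset.mem_range, not_lt] at hm
    rw [homogeneousComponent_eq_zero _ _ (by omega), map_zero]

lemma aeval_sub_C_mem {τ : Type*} (y : τ → MvPolynomial σ k) (f : MvPolynomial τ k) :
    aeval y f - C (constantCoeff f) ∈ Ideal.span (Set.range y) := by
  induction f using MvPolynomial.induction_on with
  | C a => simp [algebraMap_eq]
  | add f g hf hg =>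
    have : aeval y (f + g) - C (constantCoeff (f + g)) =
      (aeval y f - C (constantCoeff f)) + (aeval y g - C (constantCoeff g)) := by
      simp only [map_add]; ring
    rw [this]
    exact Ideal.add_mem _ hf hg
  | mul_X f i hf =>
    simp only [map_mul, aeval_X, constantCoeff_X, mul_zero, map_zero, sub_zero]
    exact Ideal.mul_mem_left _ _ (Ideal.subset_span ⟨i, rfl⟩)

/-- Homogeneous ideals, in terms of homogeneous components. -/
def IsHomog (I : Ideal (MvPolynomial σ k)) : Prop := ∀ f ∈ I, ∀ t, homogeneousComponent t f ∈ I

lemma isHomog_top : IsHomog (⊤ : Ideal (MvPolynomial σ k)) := fun _ _ _ => trivial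

end HomogeneousComponent

/-! ### Freeness of `L / N` over `k[y]`. -/

section RelBasis

variable {σ k : Type*} [Field k] {p : ℕ} {ι : Type*} [Fintype ι]

/-- The linear combination of the `g i` with coefficients the polynomials `f i` in `y`. -/
noncomputable def comb (y : Fin p → MvPolynomial σ k) (g : ι → MvPolynomial σ k)
    (f : ι → MvPolynomial (Fin p) k) : MvPolynomial σ k :=
  ∑ i, aeval y (f i) * g i

/-- For ideals `N ≤ L`, the `g i` form a basis of `L / N` over `k[y]`. -/
structure IsRelBasis (y : Fin p → MvPolynomial σ k) (L N : Ideal (MvPolynomial σ k))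
    (g : ι → MvPolynomial σ k) : Prop where
  mem : ∀ i, g i ∈ L
  span : ∀ u ∈ L, ∃ f, u - comb y g f ∈ N
  indep : ∀ f, comb y g f ∈ N → f = 0

variable {y : Fin p → MvPolynomial σ k} {g : ι → MvPolynomial σ k} {L N : Ideal (MvPolynomial σ k)}

lemma comb_add (f f' : ι → MvPolynomial (Fin p) k) : comb y g (f + f') = comb y g f + comb y g f' := by
  simp [comb, add_mul, Finset.sum_add_distrib]

lemma comb_sub (f f' : ι → MvPolynomial (Fin p) k) : comb y g (f - f') = comb y g f - comb y g f' := by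
  simp [comb, sub_mul, Finset.sum_sub_distrib]

lemma comb_zero : comb y g 0 = 0 := by simp [comb]

lemma comb_smul (r : MvPolynomial (Fin p) k) (f : ι → MvPolynomial (Fin p) k) :
    comb y g (r • f) = aeval y r * comb y g f := by
  simp [comb, Finset.mul_sum, mul_assoc]

lemma comb_single [DecidableEq ι] (i : ι) (r : MvPolynomial (Fin p) k) :
    comb y g (Pi.single i r) = aeval y r * g i := by
  rw [comb, Finset.sum_eq_single i]
  · simp
  · intro j _ hj
    simp [Pi.single_eq_of_ne hj]
  · simp

lemma comb_mem (hg : ∀ i, g i ∈ L) (f : ι → MvPolynomial (Fin p) k) : comb y g f ∈ L :=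
  Ideal.sum_mem _ fun i _ => L.mul_mem_left _ (hg i)

/-- The ideal-like set of polynomials which are combinations of the `g i` modulo `N`. -/
def combSubmonoid (y : Fin p → MvPolynomial σ k) (g : ι → MvPolynomial σ k)
    (N : Ideal (MvPolynomial σ k)) : AddSubmonoid (MvPolynomial σ k) where
  carrier := {u | ∃ f, u - comb y g f ∈ N}
  add_mem' := by
    rintro u v ⟨f, hf⟩ ⟨f', hf'⟩
    refine ⟨f + f', ?_⟩
    rw [comb_add, add_sub_add_comm]
    exact N.add_mem hf hf'
  zero_mem' := ⟨0, by rw [comb_zero, sub_zero]; exact N.zero_mem⟩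

/-- Graded Nakayama lemma. -/
lemma exists_sub_comb_mem (hy : ∀ i, (y i).IsHomogeneous 1) (hN : IsHomog N)
    {e : ι → ℕ} (hg : ∀ i, (g i).IsHomogeneous (e i))
    (hgen : ∀ u ∈ L, ∃ c : ι → k, u - ∑ i, C (c i) * g i ∈ N ⊔ Ideal.span (Set.range y) * L) :
    ∀ u ∈ L, ∃ f, u - comb y g f ∈ N := by
  classical
  have P_of_mem : ∀ u ∈ N, u ∈ combSubmonoid y g N := fun u hu =>
    ⟨0, by rwa [comb_zero, sub_zero]⟩
  have P_aeval : ∀ (r : MvPolynomial (Fin p) k) u, u ∈ combSubmonoid y g N →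
      aeval y r * u ∈ combSubmonoid y g N := by
    rintro r u ⟨f, hf⟩
    refine ⟨r • f, ?_⟩
    rw [comb_smul, ← mul_sub]
    exact N.mul_mem_left _ hf
  have P_g : ∀ i (c : k), C c * g i ∈ combSubmonoid y g N := fun i c =>
    ⟨Pi.single i (C c), by rw [comb_single]; simp [algebraMap_eq]⟩
  -- Induction on the degree: the part of degree `t` of an element of `(y)L` is a sum of products of
  -- some `y j` with parts of degree `t - 1` of elements of `L`.
  have key : ∀ t, ∀ u ∈ L, homogeneousComponent t u ∈ combSubmonoid y g N := by
    intro t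
    induction t using Nat.strong_induction_on with
    | _ t ih =>
      have hw : ∀ w ∈ Ideal.span (Set.range y) * L, homogeneousComponent t w ∈ combSubmonoid y g N := by
        intro w hw
        refine Submodule.mul_induction_on hw (fun a ha b hb => ?_) fun a b ha hb => ?_
        · induction ha using Submodule.span_induction generalizing b with
          | mem a ha =>
            obtain ⟨j, rfl⟩ := ha
            rw [mul_comm, homogeneousComponent_mul_of_isHomogeneous (hy j)]
            split_ifs with h1
            · rw [mul_comm]
              have := P_aeval (X j) _ (ih (t - 1) (by omega) b hb)
              rwa [aeval_X] at this
            · exact zero_mem _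
          | zero => rw [zero_mul, map_zero]; exact zero_mem _
          | add a a' _ _ h h' => rw [add_mul, map_add]; exact add_mem (h b hb) (h' b hb)
          | smul r a _ h =>
            rw [smul_eq_mul, mul_comm r a, mul_assoc]
            exact h (r * b) (L.mul_mem_left _ hb)
        · rw [map_add]; exact add_mem ha hb
      intro u hu
      obtain ⟨c, hc⟩ := hgen u hu
      obtain ⟨v, hv, w, hw', hvw⟩ := Submodule.mem_sup.1 hc
      have h1 : u = (∑ i, C (c i) * g i) + (v + w) := by rw [hvw]; ring
      rw [h1, map_add, map_add, map_sum]
      refine add_mem (sum_mem fun i _ => ?_)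
        (add_mem (P_of_mem _ (hN v hv t)) (hw w hw'))
      rw [homogeneousComponent_of_mem ((hg i).C_mul (c i))]
      split_ifs
      · exact P_g i (c i)
      · exact zero_mem _
  intro u hu
  rw [← sum_homogeneousComponent u]
  exact sum_mem (S := combSubmonoid y g N) fun t _ => key t u hu

lemma aeval_eq_coeff_zero_add {p : ℕ} (y : Fin (p + 1) → MvPolynomial σ k)
    (f : MvPolynomial (Fin (p + 1)) k) :
    aeval y f = aeval (fun i : Fin p => y i.succ) ((finSuccEquiv k p f).coeff 0) +
      y 0 * aeval y ((finSuccEquiv k p).symm (finSuccEquiv k p f).divX) := by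
  have h : f = rename Fin.succ ((finSuccEquiv k p f).coeff 0) +
      X 0 * (finSuccEquiv k p).symm (finSuccEquiv k p f).divX := by
    apply (finSuccEquiv k p).injective
    have hren : ∀ q : MvPolynomial (Fin p) k,
        finSuccEquiv k p (rename Fin.succ q) = Polynomial.C q := by
      intro q
      induction q using MvPolynomial.induction_on with
      | C a => simp [finSuccEquiv_apply]
      | add q q' h h' => simp only [map_add, h, h']
      | mul_X q i h => simp only [map_mul, h, rename_X, finSuccEquiv_X_succ]
    rw [map_add, map_mul, finSuccEquiv_X_zero, AlgEquiv.apply_symm_apply, hren]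
    conv_lhs => rw [← Polynomial.X_mul_divX_add (finSuccEquiv k p f)]
    rw [add_comm]
  conv_lhs => rw [h]
  rw [map_add, map_mul, aeval_X, aeval_rename]
  rfl

/-- Elements of `L / N` which are linearly independent over `k` modulo a regular sequence `y` are
linearly independent over `k[y]`. -/
lemma eq_zero_of_comb_mem (hg : ∀ i, g i ∈ L) (hreg : RegOn L N (List.ofFn y))
    (hind : ∀ c : ι → k, ∑ i, C (c i) * g i ∈ N ⊔ Ideal.ofList (List.ofFn y) * L → c = 0)
    (f : ι → MvPolynomial (Fin p) k) (hf : comb y g f ∈ N) : f = 0 := by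
  induction p generalizing N with
  | zero =>
    have h : ∀ i, f i = C (constantCoeff (f i)) := fun i => by
      rw [constantCoeff_eq]
      exact eq_C_of_isEmpty (f i)
    have := hind (fun i => constantCoeff (f i)) (by
      refine le_sup_left (a := N) ?_
      convert! hf using 1
      refine Finset.sum_congr rfl fun i _ => ?_
      conv_rhs => rw [h i]
      simp [algebraMap_eq])
    funext i
    rw [h i, congrFun this i]
    simp
  | succ p ih =>
    rw [List.ofFn_succ] at hreg hind
    rw [RegOn] at hreg
    rw [Ideal.ofList_cons, Ideal.sup_mul, ← sup_assoc] at hind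
    -- Inner induction on a bound `D` for the degree in the first variable. Writing `f = f₀ + X₀
    -- f₁`, the induction on `p` over `N + y₀ L` gives `f₀ = 0`; regularity of `y₀` then puts the
    -- combination of `f₁` in `N`, with a smaller bound.
    suffices H : ∀ (D : ℕ) (f : ι → MvPolynomial (Fin (p + 1)) k),
        (∀ i j, D ≤ j → (finSuccEquiv k p (f i)).coeff j = 0) → comb y g f ∈ N → f = 0 by
      refine H (Finset.univ.sup (fun i => (finSuccEquiv k p (f i)).natDegree) + 1) f
        (fun i j hj => Polynomial.coeff_eq_zero_of_natDegree_lt ?_) hf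
      have := Finset.le_sup (f := fun i => (finSuccEquiv k p (f i)).natDegree) (Finset.mem_univ i)
      exact lt_of_le_of_lt this hj
    intro D
    induction D with
    | zero =>
      intro f hf _
      funext i
      apply (finSuccEquiv k p).injective
      ext1 j
      rw [hf i j (Nat.zero_le j)]
      simp
    | succ D ihD =>
      intro f hfD hf
      let f₀ : ι → MvPolynomial (Fin p) k := fun i => (finSuccEquiv k p (f i)).coeff 0
      let f₁ : ι → MvPolynomial (Fin (p + 1)) k := fun i =>
        (finSuccEquiv k p).symm (finSuccEquiv k p (f i)).divX
      have hsplit : comb y g f = comb (fun i => y i.succ) g f₀ + y 0 * comb y g f₁ := by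
        rw [comb, comb, comb, Finset.mul_sum, ← Finset.sum_add_distrib]
        refine Finset.sum_congr rfl fun i _ => ?_
        rw [aeval_eq_coeff_zero_add, add_mul, mul_assoc]
      have h0 : f₀ = 0 := by
        refine ih hreg.2 hind f₀ ?_
        have : comb (fun i => y i.succ) g f₀ = comb y g f + -(y 0 * comb y g f₁) := by
          rw [hsplit]; ring
        rw [this]
        exact Submodule.add_mem_sup hf (Ideal.neg_mem_iff _ |>.2
          (Ideal.mul_mem_mul (Ideal.mem_span_singleton_self _) (comb_mem hg f₁)))
      have h1 : f₁ = 0 := by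
        refine ihD f₁ (fun i j hj => ?_) ?_
        · rw [AlgEquiv.apply_symm_apply, Polynomial.coeff_divX]
          exact hfD i (j + 1) (by omega)
        · refine hreg.1 _ (comb_mem hg f₁) ?_
          rwa [hsplit, h0, comb_zero, zero_add] at hf
      funext i
      apply (finSuccEquiv k p).injective
      rw [← Polynomial.divX_mul_X_add (finSuccEquiv k p (f i))]
      have h2 : (finSuccEquiv k p (f i)).divX = 0 := by
        have := congrArg (finSuccEquiv k p) (congrFun h1 i)
        simpa [f₁] using this
      have h3 : (finSuccEquiv k p (f i)).coeff 0 = 0 := congrFun h0 i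
      rw [h2, h3]
      simp

lemma ofList_ofFn {S : Type*} [CommSemiring S] (y : Fin p → S) :
    Ideal.ofList (List.ofFn y) = Ideal.span (Set.range y) := by
  rw [Ideal.ofList]
  congr 1
  ext x
  simp [List.mem_ofFn]

/-- The case of the single generator `1` of `S / N`: a regular sequence is algebraically independent
modulo `N`. -/
lemma aeval_injective_of_regOn (hreg : RegOn ⊤ N (List.ofFn y))
    (htop : N ⊔ Ideal.span (Set.range y) ≠ ⊤) (f : MvPolynomial (Fin p) k) (hf : aeval y f ∈ N) :
    f = 0 := by
  have := eq_zero_of_comb_mem (ι := Unit) (g := fun _ => 1) (L := ⊤) (N := N) (y := y)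
    (fun _ => trivial) hreg (fun c hc => ?_) (fun _ => f) (by simpa [comb] using hf)
  · exact congrFun this ()
  · funext i
    by_contra hne
    apply htop
    rw [ofList_ofFn, Ideal.mul_top] at hc
    refine Ideal.eq_top_of_isUnit_mem _ hc ?_
    rw [Fintype.sum_unique, mul_one]
    exact (isUnit_iff_ne_zero.2 hne).map C

/-- Homogeneous lifts of a `k`-basis of `L / (N + (y)L)` generate by graded Nakayama and are
independent by regularity. The basis is extracted from the homogeneous components of the given
generators and then sorted by degree. -/
lemma exists_isRelBasis (hy : ∀ i, (y i).IsHomogeneous 1) (hL : IsHomog L) (hN : IsHomog N)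
    (hreg : RegOn L N (List.ofFn y))
    (hfin : ∃ (r : ℕ) (u : Fin r → MvPolynomial σ k), (∀ i, u i ∈ L) ∧ ∀ x ∈ L, ∃ c : Fin r → k,
      x - ∑ i, C (c i) * u i ∈ N ⊔ Ideal.span (Set.range y) * L) :
    ∃ (d : ℕ) (e : Fin d → ℕ) (g : Fin d → MvPolynomial σ k), Monotone e ∧
      (∀ i, (g i).IsHomogeneous (e i)) ∧ IsRelBasis y L N g ∧
      (∀ c : Fin d → k, ∑ i, C (c i) * g i ∈ N ⊔ Ideal.span (Set.range y) * L → c = 0) ∧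
      ∀ x ∈ L, ∃ c : Fin d → k, x - ∑ i, C (c i) * g i ∈ N ⊔ Ideal.span (Set.range y) * L := by
  obtain ⟨r, u, huL, hu⟩ := hfin
  set Q := N ⊔ Ideal.span (Set.range y) * L with hQ
  let ι' := Σ i : Fin r, Fin ((u i).totalDegree + 1)
  let v : ι' → MvPolynomial σ k := fun i => homogeneousComponent i.2 (u i.1)
  let π : MvPolynomial σ k →ₗ[k] MvPolynomial σ k ⧸ Q := (Ideal.Quotient.mkₐ k Q).toLinearMap
  have hπ : ∀ x, π x = 0 ↔ x ∈ Q := fun x => Ideal.Quotient.eq_zero_iff_mem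
  have hπC : ∀ {α : Type} [Fintype α] (c : α → k) (w : α → MvPolynomial σ k),
      π (∑ i, C (c i) * w i) = ∑ i, c i • π (w i) := by
    intro α _ c w
    rw [map_sum]
    refine Finset.sum_congr rfl fun i _ => ?_
    rw [← smul_eq_C_mul, map_smul]
  obtain ⟨κ, a, ha, hspan, hli⟩ := exists_linearIndependent' k (fun i => π (v i))
  have : Finite κ := Finite.of_injective a ha
  let ε : κ ≃ Fin (Nat.card κ) := Finite.equivFin κ
  let e₀ : Fin (Nat.card κ) → ℕ := fun i => (a (ε.symm i)).2
  let ρ : Fin (Nat.card κ) ≃ κ := (Tuple.sort e₀).trans ε.symm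
  let g : Fin (Nat.card κ) → MvPolynomial σ k := fun i => v (a (ρ i))
  have hgL : ∀ i, g i ∈ L := fun i => hL _ (huL _) _
  have hghom : ∀ i, (g i).IsHomogeneous ((e₀ ∘ Tuple.sort e₀) i) := fun i =>
    homogeneousComponent_isHomogeneous _ _
  have hind : ∀ c : Fin (Nat.card κ) → k, ∑ i, C (c i) * g i ∈ Q → c = 0 := by
    intro c hc
    rw [← hπ, hπC] at hc
    have := hli.comp ρ ρ.injective
    rw [Fintype.linearIndependent_iff] at this
    funext i
    exact this c hc i
  have hgen : ∀ x ∈ L, ∃ c : Fin (Nat.card κ) → k, x - ∑ i, C (c i) * g i ∈ Q := by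
    intro x hx
    obtain ⟨c, hc⟩ := hu x hx
    rw [← hπ, map_sub, hπC, sub_eq_zero] at hc
    have hrange : Set.range (fun i => π (g i)) = Set.range ((fun i => π (v i)) ∘ a) := by
      ext z
      constructor
      · rintro ⟨i, rfl⟩; exact ⟨ρ i, rfl⟩
      · rintro ⟨i, rfl⟩; exact ⟨ρ.symm i, by simp [g]⟩
    have hmem : π x ∈ Submodule.span k (Set.range fun i => π (g i)) := by
      rw [hrange, hspan, hc]
      refine Submodule.sum_mem _ fun i _ => Submodule.smul_mem _ _ ?_
      rw [← sum_homogeneousComponent (u i), map_sum]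
      refine Submodule.sum_mem _ fun t ht => Submodule.subset_span ?_
      exact ⟨⟨i, ⟨t, Finset.mem_range.1 ht⟩⟩, rfl⟩
    obtain ⟨c', hc'⟩ := (Submodule.mem_span_range_iff_exists_fun k).1 hmem
    refine ⟨c', ?_⟩
    rw [← hπ, map_sub, hπC, hc', sub_self]
  refine ⟨Nat.card κ, e₀ ∘ Tuple.sort e₀, g, Tuple.monotone_sort e₀, hghom,
    ⟨hgL, exists_sub_comb_mem hy hN hghom hgen, eq_zero_of_comb_mem hgL hreg ?_⟩, hind, hgen⟩
  rwa [ofList_ofFn]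

/-- Coordinates embed `L / N` in the free module `S / N` over the noetherian ring `k[y]`, so it is
finitely generated; modulo `(y)L` only the constant terms of the coefficients survive. -/
lemma IsRelBasis.finite_generation [Finite σ] {d : ℕ} {a : Fin d → MvPolynomial σ k}
    (ha : IsRelBasis y ⊤ N a) (hNL : N ≤ L) :
    ∃ (r : ℕ) (u : Fin r → MvPolynomial σ k), (∀ i, u i ∈ L) ∧ ∀ x ∈ L, ∃ c : Fin r → k,
      x - ∑ i, C (c i) * u i ∈ N ⊔ Ideal.span (Set.range y) * L := by
  let K : Submodule (MvPolynomial (Fin p) k) (Fin d → MvPolynomial (Fin p) k) :=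
    { carrier := {f | comb y a f ∈ L}
      add_mem' := fun hf hf' => by
        change comb _ _ _ ∈ L; rw [comb_add]; exact L.add_mem hf hf'
      zero_mem' := by
        change comb _ _ _ ∈ L; rw [comb_zero]; exact L.zero_mem
      smul_mem' := fun r f hf => by
        change comb _ _ _ ∈ L; rw [comb_smul]; exact L.mul_mem_left _ hf }
  obtain ⟨r, s, hs⟩ := Submodule.fg_iff_exists_fin_generating_family.1 (IsNoetherian.noetherian K)
  have hsK : ∀ i, comb y a (s i) ∈ L := fun i =>
    (hs ▸ Submodule.subset_span ⟨i, rfl⟩ : s i ∈ K)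
  refine ⟨r, fun i => comb y a (s i), hsK, fun x hx => ?_⟩
  obtain ⟨f, hf⟩ := ha.span x trivial
  have hfK : f ∈ K := by
    have : comb y a f = x - (x - comb y a f) := by ring
    change comb y a f ∈ L
    rw [this]
    exact L.sub_mem hx (hNL hf)
  rw [← hs] at hfK
  obtain ⟨c, rfl⟩ := (Submodule.mem_span_range_iff_exists_fun _).1 hfK
  have hcomb : comb y a (∑ i, c i • s i) = ∑ i, aeval y (c i) * comb y a (s i) := by
    simp_rw [← comb_smul]
    have : ∀ t : Finset (Fin r), comb y a (∑ i ∈ t, c i • s i) = ∑ i ∈ t, comb y a (c i • s i) := by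
      intro t
      induction t using Finset.cons_induction with
      | empty => simp [comb_zero]
      | cons i t hi ih => rw [Finset.sum_cons, comb_add, ih, Finset.sum_cons]
    exact this _
  refine ⟨fun i => constantCoeff (c i), ?_⟩
  have : x - ∑ i, C (constantCoeff (c i)) * comb y a (s i) =
      (x - comb y a (∑ i, c i • s i)) +
        ∑ i, (aeval y (c i) - C (constantCoeff (c i))) * comb y a (s i) := by
    simp_rw [sub_mul]
    rw [Finset.sum_sub_distrib, hcomb]
    ring
  rw [this]
  exact Submodule.add_mem_sup hf
    (Ideal.sum_mem _ fun i _ => Ideal.mul_mem_mul (aeval_sub_C_mem y (c i)) (hsK i))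

end RelBasis

end ProjACM

namespace ProjACM

open MvPolynomial

/-! ### Hilbert functions determine the degrees of a homogeneous basis. -/

section HilbertFunction

variable {σ k : Type*} [Field k] {p : ℕ} {y : Fin p → MvPolynomial σ k}
  {L N : Ideal (MvPolynomial σ k)}

/-- The component of degree `t` of `L / N`. -/
noncomputable def gradedPiece (L N : Ideal (MvPolynomial σ k)) (t : ℕ) :
    Submodule k (MvPolynomial σ k ⧸ N) :=
  (L.restrictScalars k ⊓ homogeneousSubmodule σ k t).map (Ideal.Quotient.mkₐ k N).toLinearMap

lemma comb_isHomogeneous {ι : Type*} [Fintype ι] (hy : ∀ i, (y i).IsHomogeneous 1)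
    {g : ι → MvPolynomial σ k} {e : ι → ℕ} (hg : ∀ i, (g i).IsHomogeneous (e i)) {t : ℕ}
    {f : ι → MvPolynomial (Fin p) k}
    (hf : ∀ i, f i ∈ if e i ≤ t then homogeneousSubmodule (Fin p) k (t - e i) else ⊥) :
    (comb y g f).IsHomogeneous t := by
  refine IsHomogeneous.sum _ _ _ fun i _ => ?_
  have := hf i
  split_ifs at this with h
  · have h1 := (IsHomogeneous.aeval ((mem_homogeneousSubmodule _ _).1 this) y hy).mul (hg i)
    rwa [one_mul, Nat.sub_add_cancel h] at h1
  · rw [(Submodule.mem_bot _).1 this, map_zero, zero_mul]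
    exact isHomogeneous_zero _ _ _

lemma homogeneousComponent_comb {ι : Type*} [Fintype ι] (hy : ∀ i, (y i).IsHomogeneous 1)
    {g : ι → MvPolynomial σ k} {e : ι → ℕ} (hg : ∀ i, (g i).IsHomogeneous (e i)) (t : ℕ)
    (f : ι → MvPolynomial (Fin p) k) :
    homogeneousComponent t (comb y g f) =
      comb y g fun i => if e i ≤ t then homogeneousComponent (t - e i) (f i) else 0 := by
  rw [comb, comb, map_sum]
  refine Finset.sum_congr rfl fun i _ => ?_
  rw [homogeneousComponent_mul_of_isHomogeneous (hg i), homogeneousComponent_aeval hy]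
  split_ifs
  · rfl
  · rw [map_zero, zero_mul]

instance finite_homogeneousSubmodule (t : ℕ) :
    Module.Finite k (homogeneousSubmodule (Fin p) k t) :=
  Module.Finite.iff_fg.2 (homogeneousSubmodule_fg _ _ t)

/-- Combinations with `f i` of degree `t - e i` identify the direct sum of these graded pieces of
the polynomial ring with the piece of degree `t` of `L / N`. The left side depends on neither `y`
nor `g`. -/
lemma IsRelBasis.finrank_gradedPiece {d : ℕ} {g : Fin d → MvPolynomial σ k}
    (hb : IsRelBasis y L N g) (hy : ∀ i, (y i).IsHomogeneous 1) (hN : IsHomog N) {e : Fin d → ℕ}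
    (hg : ∀ i, (g i).IsHomogeneous (e i)) (t : ℕ) :
    Module.finrank k (gradedPiece L N t) = ∑ i, if e i ≤ t then
      Module.finrank k (homogeneousSubmodule (Fin p) k (t - e i)) else 0 := by
  let W : Fin d → Submodule k (MvPolynomial (Fin p) k) := fun i =>
    if e i ≤ t then homogeneousSubmodule (Fin p) k (t - e i) else ⊥
  have hWfin : ∀ i, Module.Finite k (W i) := by
    intro i
    by_cases h : e i ≤ t
    · rw [show W i = _ from if_pos h]; infer_instance
    · rw [show W i = _ from if_neg h]; infer_instance
  let π : MvPolynomial σ k →ₗ[k] MvPolynomial σ k ⧸ N := (Ideal.Quotient.mkₐ k N).toLinearMap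
  have hπ : ∀ x, π x = 0 ↔ x ∈ N := fun x => Ideal.Quotient.eq_zero_iff_mem
  let Φ : (Π i, W i) →ₗ[k] (MvPolynomial σ k ⧸ N) :=
    { toFun := fun f => π (comb y g fun i => (f i : MvPolynomial (Fin p) k))
      map_add' := fun f f' => by rw [← map_add, ← comb_add]; rfl
      map_smul' := fun c f => by
        have : (fun i => ((c • f) i : MvPolynomial (Fin p) k)) =
            (C c : MvPolynomial (Fin p) k) • fun i => (f i : MvPolynomial (Fin p) k) := by
          funext i
          simp [smul_eq_C_mul]
        rw [this, comb_smul, aeval_C, algebraMap_eq, ← smul_eq_C_mul, map_smul]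
        rfl }
  have hΦ : Function.Injective Φ := by
    rw [injective_iff_map_eq_zero]
    intro f hf
    have := hb.indep _ ((hπ _).1 hf)
    funext i
    exact Subtype.ext (congrFun this i)
  have hrange : LinearMap.range Φ = gradedPiece L N t := by
    apply le_antisymm
    · rintro _ ⟨f, rfl⟩
      exact ⟨_, ⟨comb_mem hb.mem _, comb_isHomogeneous hy hg fun i => (f i).2⟩, rfl⟩
    · rintro _ ⟨u, ⟨huL, hu⟩, rfl⟩
      obtain ⟨f, hf⟩ := hb.span u huL
      refine ⟨fun i => ⟨if e i ≤ t then homogeneousComponent (t - e i) (f i) else 0, ?_⟩, ?_⟩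
      · simp only [W]
        split_ifs
        · exact homogeneousComponent_mem _ _
        · exact Submodule.zero_mem _
      · change π _ = π u
        rw [← sub_eq_zero, ← map_sub, hπ, ← homogeneousComponent_comb hy hg,
          ← neg_sub, Ideal.neg_mem_iff]
        have := hN _ hf t
        rwa [map_sub, homogeneousComponent_eq_self hu] at this
  rw [← hrange, LinearMap.finrank_range_of_inj hΦ, Module.finrank_pi_fintype]
  refine Finset.sum_congr rfl fun i _ => ?_
  by_cases h : e i ≤ t
  · rw [show W i = _ from if_pos h, if_pos h]
  · rw [show W i = _ from if_neg h, if_neg h, finrank_bot]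

/-- As `r 0 = 1`, the value at `t` determines the number of indices of degree `t` from the numbers
in smaller degrees; a monotone sequence is determined by its multiset of values. -/
lemma sigma_eq_of_sum_eq {r : ℕ → ℕ} (hr : r 0 = 1) {d d' : ℕ} {e : Fin d → ℕ} {e' : Fin d' → ℕ}
    (he : Monotone e) (he' : Monotone e')
    (h : ∀ t, (∑ i, if e i ≤ t then r (t - e i) else 0) = ∑ i, if e' i ≤ t then r (t - e' i) else 0) :
    (⟨d, e⟩ : Σ d, Fin d → ℕ) = ⟨d', e'⟩ := by
  have key : ∀ {d : ℕ} (e : Fin d → ℕ) (t : ℕ), (∑ i, if e i ≤ t then r (t - e i) else 0) =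
      ∑ s ∈ Finset.range (t + 1), (Multiset.map e Finset.univ.val).count s * r (t - s) := by
    intro d e t
    have h1 : ∀ i, (if e i ≤ t then r (t - e i) else 0) =
        ∑ s ∈ Finset.range (t + 1), if s = e i then r (t - s) else 0 := by
      intro i
      rw [Finset.sum_ite_eq']
      simp
    simp_rw [h1]
    rw [Finset.sum_comm]
    refine Finset.sum_congr rfl fun s _ => ?_
    rw [← Finset.sum_filter, Finset.sum_const, smul_eq_mul, Multiset.count_map]
    rfl
  have hcount : ∀ t, (Multiset.map e Finset.univ.val).count t =
      (Multiset.map e' Finset.univ.val).count t := by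
    intro t
    induction t using Nat.strong_induction_on with
    | _ t ih =>
      have := h t
      rw [key, key, Finset.sum_range_succ, Finset.sum_range_succ, Nat.sub_self, hr, mul_one, mul_one,
        Finset.sum_congr rfl fun s hs => by rw [ih s (Finset.mem_range.1 hs)]] at this
      exact Nat.add_left_cancel this
  have hmul : Multiset.map e Finset.univ.val = Multiset.map e' Finset.univ.val :=
    Multiset.ext.2 hcount
  rw [Fin.univ_val_map, Fin.univ_val_map, Multiset.coe_eq_coe] at hmul
  rw [← List.ofFn_inj']
  exact hmul.eq_of_sortedLE he.sortedLE_ofFn he'.sortedLE_ofFn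

/-- The degrees of a homogeneous basis of `L / N` over `k[y]` do not depend on the choice of the
linear forms `y` and of the basis. -/
lemma IsRelBasis.sigma_eq {y' : Fin p → MvPolynomial σ k} {d d' : ℕ} {g : Fin d → MvPolynomial σ k}
    {g' : Fin d' → MvPolynomial σ k} (hb : IsRelBasis y L N g) (hb' : IsRelBasis y' L N g')
    (hy : ∀ i, (y i).IsHomogeneous 1) (hy' : ∀ i, (y' i).IsHomogeneous 1) (hN : IsHomog N)
    {e : Fin d → ℕ} {e' : Fin d' → ℕ} (hg : ∀ i, (g i).IsHomogeneous (e i))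
    (hg' : ∀ i, (g' i).IsHomogeneous (e' i)) (he : Monotone e) (he' : Monotone e') :
    (⟨d, e⟩ : Σ d, Fin d → ℕ) = ⟨d', e'⟩ := by
  refine sigma_eq_of_sum_eq (r := fun t => Module.finrank k (homogeneousSubmodule (Fin p) k t))
    ?_ he he' fun t => ?_
  · rw [homogeneousSubmodule_zero]
    have h1 : (1 : MvPolynomial (Fin p) k) ≠ 0 := one_ne_zero
    rw [Submodule.one_eq_span]
    exact finrank_span_singleton h1
  · rw [← hb.finrank_gradedPiece hy hN hg, ← hb'.finrank_gradedPiece hy' hN hg']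

end HilbertFunction

/-! ### Bases over the subalgebra `k[y]` and combinations with polynomial coefficients. -/

section Bridge

variable {k : Type*} [Field k] {n m : ℕ} {y : Fin (m + 1) → MvPolynomial (Fin (n + 1)) k}
  {L N : Ideal (MvPolynomial (Fin (n + 1)) k)}

lemma exists_aeval_eq (r : Algebra.adjoin k (Set.range y)) :
    ∃ f : MvPolynomial (Fin (m + 1)) k, aeval y f = r := by
  have h : (r : MvPolynomial (Fin (n + 1)) k) ∈ (aeval y : MvPolynomial (Fin (m + 1)) k →ₐ[k] _).range := by
    rw [← Algebra.adjoin_range_eq_range_aeval]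
    exact r.2
  exact h

lemma aeval_mem_adjoin (f : MvPolynomial (Fin (m + 1)) k) :
    aeval y f ∈ Algebra.adjoin k (Set.range y) := by
  rw [Algebra.adjoin_range_eq_range_aeval]
  exact ⟨f, rfl⟩

/-- Independence over the subalgebra only kills the values `aeval y (f i)`; `hinj` is what makes the
polynomials `f i` themselves vanish. -/
lemma HasHomogeneousBasis.exists_isRelBasis (hNL : N ≤ L)
    (hinj : ∀ f : MvPolynomial (Fin (m + 1)) k, aeval y f ∈ N → f = 0) {d : ℕ} {e : Fin d → ℕ}
    (h : HasHomogeneousBasis y (L.map (Ideal.Quotient.mk N)) e) :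
    ∃ g : Fin d → MvPolynomial (Fin (n + 1)) k, (∀ i, (g i).IsHomogeneous (e i)) ∧
      IsRelBasis y L N g := by
  obtain ⟨b, hb⟩ := h
  choose g hg hgb using hb
  have hcoe : ∀ r : Fin d → Algebra.adjoin k (Set.range y),
      ((∑ i, r i • b i : L.map (Ideal.Quotient.mk N)) : MvPolynomial (Fin (n + 1)) k ⧸ N) =
        Ideal.Quotient.mk N (∑ i, (r i : MvPolynomial (Fin (n + 1)) k) * g i) := by
    intro r
    rw [AddSubmonoidClass.coe_finsetSum, map_sum]
    refine Finset.sum_congr rfl fun i _ => ?_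
    rw [map_mul, hgb i]
    rfl
  refine ⟨g, hg, fun i => ?_, fun u hu => ?_, fun f hf => ?_⟩
  · rw [← Ideal.mem_quotient_iff_mem hNL, hgb]
    exact (b i).2
  · let x : L.map (Ideal.Quotient.mk N) := ⟨Ideal.Quotient.mk N u, Ideal.mem_map_of_mem _ hu⟩
    choose f hf using fun i => exists_aeval_eq (b.repr x i)
    refine ⟨f, ?_⟩
    have := hcoe (b.repr x)
    rw [b.sum_repr x] at this
    rw [← Ideal.Quotient.eq]
    refine this.trans ?_
    simp_rw [← hf]
    rfl
  · have h0 : ∑ i, (⟨aeval y (f i), aeval_mem_adjoin (f i)⟩ : Algebra.adjoin k (Set.range y)) • b i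
        = 0 := by
      apply Subtype.ext
      rw [hcoe]
      exact Ideal.Quotient.eq_zero_iff_mem.2 hf
    have h1 := Fintype.linearIndependent_iff.1 b.linearIndependent _ h0
    funext i
    refine hinj _ ?_
    have := congrArg Subtype.val (h1 i)
    change aeval y (f i) = 0 at this
    rw [this]
    exact N.zero_mem

lemma IsRelBasis.hasHomogeneousBasis {d : ℕ} {e : Fin d → ℕ}
    {g : Fin d → MvPolynomial (Fin (n + 1)) k} (hb : IsRelBasis y L N g)
    (hg : ∀ i, (g i).IsHomogeneous (e i)) :
    HasHomogeneousBasis y (L.map (Ideal.Quotient.mk N)) e := by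
  let v : Fin d → L.map (Ideal.Quotient.mk N) := fun i =>
    ⟨Ideal.Quotient.mk N (g i), Ideal.mem_map_of_mem _ (hb.mem i)⟩
  have hcoe : ∀ r : Fin d → Algebra.adjoin k (Set.range y),
      ((∑ i, r i • v i : L.map (Ideal.Quotient.mk N)) : MvPolynomial (Fin (n + 1)) k ⧸ N) =
        Ideal.Quotient.mk N (∑ i, (r i : MvPolynomial (Fin (n + 1)) k) * g i) := by
    intro r
    rw [AddSubmonoidClass.coe_finsetSum, map_sum]
    refine Finset.sum_congr rfl fun i _ => ?_
    rw [map_mul]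
    rfl
  have hli : LinearIndependent (Algebra.adjoin k (Set.range y)) v := by
    rw [Fintype.linearIndependent_iff]
    intro r hr i
    choose f hf using fun i => exists_aeval_eq (r i)
    have h1 := hcoe r
    rw [hr] at h1
    have h2 := hb.indep f (Ideal.Quotient.eq_zero_iff_mem.1 (by
      refine Eq.trans ?_ h1.symm
      simp_rw [← hf]
      rfl))
    apply Subtype.ext
    rw [← hf, h2]
    simp
  have hsp : ⊤ ≤ Submodule.span (Algebra.adjoin k (Set.range y)) (Set.range v) := by
    rintro ⟨x, hx⟩ -
    obtain ⟨u, hu, rfl⟩ := (Ideal.mem_map_iff_of_surjective _ Ideal.Quotient.mk_surjective).1 hx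
    obtain ⟨f, hf⟩ := hb.span u hu
    rw [Submodule.mem_span_range_iff_exists_fun]
    refine ⟨fun i => ⟨aeval y (f i), aeval_mem_adjoin (f i)⟩, Subtype.ext ?_⟩
    rw [hcoe]
    exact (Ideal.Quotient.eq.2 hf).symm
  refine ⟨Module.Basis.mk hli hsp, fun i => ⟨g i, hg i, ?_⟩⟩
  rw [Module.Basis.mk_apply]

end Bridge

end ProjACM

namespace ProjACM

open MvPolynomial

/-! ### Coordinates and linear forms over `k[y]`. -/

section Coordinates

variable {σ k : Type*} [Field k] {p : ℕ} {ι : Type*} [Fintype ι] {y : Fin p → MvPolynomial σ k}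
  {g : ι → MvPolynomial σ k} {L N : Ideal (MvPolynomial σ k)}

open Classical in
/-- The coordinates of `u` with respect to a basis `g` of `L / N` over `k[y]`. -/
noncomputable def coords (y : Fin p → MvPolynomial σ k) (g : ι → MvPolynomial σ k)
    (N : Ideal (MvPolynomial σ k)) (u : MvPolynomial σ k) : ι → MvPolynomial (Fin p) k :=
  if h : ∃ f, u - comb y g f ∈ N then h.choose else 0

lemma IsRelBasis.sub_comb_coords_mem (hb : IsRelBasis y L N g) {u : MvPolynomial σ k} (hu : u ∈ L) :
    u - comb y g (coords y g N u) ∈ N := by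
  rw [coords, dif_pos (hb.span u hu)]
  exact (hb.span u hu).choose_spec

lemma IsRelBasis.coords_eq (hb : IsRelBasis y L N g) {u : MvPolynomial σ k}
    {f : ι → MvPolynomial (Fin p) k} (h : u - comb y g f ∈ N) : coords y g N u = f := by
  have hex : ∃ f, u - comb y g f ∈ N := ⟨f, h⟩
  rw [coords, dif_pos hex, ← sub_eq_zero]
  refine hb.indep _ ?_
  rw [comb_sub]
  have : comb y g hex.choose - comb y g f = (u - comb y g f) - (u - comb y g hex.choose) := by ring
  rw [this]
  exact N.sub_mem h hex.choose_spec

/-- `ψ` induces a `k[y]`-linear form on `L / N`. -/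
structure IsLinearForm (y : Fin p → MvPolynomial σ k) (L N : Ideal (MvPolynomial σ k))
    (ψ : MvPolynomial σ k → MvPolynomial (Fin p) k) : Prop where
  map_add : ∀ u ∈ L, ∀ v ∈ L, ψ (u + v) = ψ u + ψ v
  map_smul : ∀ r, ∀ u ∈ L, ψ (aeval y r * u) = r * ψ u
  map_eq_zero : ∀ u ∈ N, ψ u = 0

lemma IsRelBasis.isLinearForm_coords (hb : IsRelBasis y L N g) (i : ι) :
    IsLinearForm y L N (fun u => coords y g N u i) where
  map_add u hu v hv := by
    rw [hb.coords_eq (f := coords y g N u + coords y g N v)]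
    · rfl
    · rw [comb_add, add_sub_add_comm]
      exact N.add_mem (hb.sub_comb_coords_mem hu) (hb.sub_comb_coords_mem hv)
  map_smul r u hu := by
    rw [hb.coords_eq (f := r • coords y g N u)]
    · rfl
    · rw [comb_smul, ← mul_sub]
      exact N.mul_mem_left _ (hb.sub_comb_coords_mem hu)
  map_eq_zero u hu := by
    rw [hb.coords_eq (f := 0)]
    · rfl
    · rwa [comb_zero, sub_zero]

lemma IsRelBasis.coords_apply_self [DecidableEq ι] (hb : IsRelBasis y L N g) (i : ι) :
    coords y g N (g i) = Pi.single i 1 := by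
  refine hb.coords_eq ?_
  rw [comb_single, map_one, one_mul, sub_self]
  exact N.zero_mem

lemma IsRelBasis.coords_homogeneousComponent (hb : IsRelBasis y L N g)
    (hy : ∀ i, (y i).IsHomogeneous 1) (hN : IsHomog N) {e : ι → ℕ}
    (hg : ∀ i, (g i).IsHomogeneous (e i)) {u : MvPolynomial σ k} (hu : u ∈ L) (t : ℕ) (i : ι) :
    coords y g N (homogeneousComponent t u) i =
      if e i ≤ t then homogeneousComponent (t - e i) (coords y g N u i) else 0 := by
  rw [hb.coords_eq (f := fun i => if e i ≤ t then
    homogeneousComponent (t - e i) (coords y g N u i) else 0)]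
  rw [← homogeneousComponent_comb hy hg, ← map_sub]
  exact hN _ (hb.sub_comb_coords_mem hu) t

lemma IsRelBasis.congr {g' : ι → MvPolynomial σ k} (hb : IsRelBasis y L N g) (hNL : N ≤ L)
    (h : ∀ i, g i - g' i ∈ N) : IsRelBasis y L N g' := by
  have hcomb : ∀ f, comb y g f - comb y g' f ∈ N := by
    intro f
    rw [comb, comb, ← Finset.sum_sub_distrib]
    refine Ideal.sum_mem _ fun i _ => ?_
    rw [← mul_sub]
    exact N.mul_mem_left _ (h i)
  refine ⟨fun i => ?_, fun u hu => ?_, fun f hf => ?_⟩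
  · have : g' i = g i - (g i - g' i) := by ring
    rw [this]
    exact L.sub_mem (hb.mem i) (hNL (h i))
  · obtain ⟨f, hf⟩ := hb.span u hu
    refine ⟨f, ?_⟩
    have : u - comb y g' f = (u - comb y g f) + (comb y g f - comb y g' f) := by ring
    rw [this]
    exact N.add_mem hf (hcomb f)
  · refine hb.indep f ?_
    have : comb y g f = comb y g' f + (comb y g f - comb y g' f) := by ring
    rw [this]
    exact N.add_mem hf (hcomb f)

namespace IsLinearForm

variable {ψ : MvPolynomial σ k → MvPolynomial (Fin p) k}

lemma map_zero (hψ : IsLinearForm y L N ψ) : ψ 0 = 0 := hψ.map_eq_zero 0 N.zero_mem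

lemma map_congr (hψ : IsLinearForm y L N ψ) (hNL : N ≤ L) {u v : MvPolynomial σ k} (hv : v ∈ L)
    (h : u - v ∈ N) : ψ u = ψ v := by
  have := hψ.map_add (u - v) (hNL h) v hv
  rwa [sub_add_cancel, hψ.map_eq_zero _ h, zero_add] at this

lemma map_sum (hψ : IsLinearForm y L N ψ) {α : Type*} (s : Finset α) (w : α → MvPolynomial σ k)
    (hw : ∀ i, w i ∈ L) : ψ (∑ i ∈ s, w i) = ∑ i ∈ s, ψ (w i) := by
  classical
  induction s using Finset.cons_induction with
  | empty => simpa using hψ.map_zero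
  | cons i s hi ih =>
    rw [Finset.sum_cons, Finset.sum_cons, hψ.map_add _ (hw i) _ (Ideal.sum_mem _ fun j _ => hw j), ih]

lemma map_comb (hψ : IsLinearForm y L N ψ) {α : Type*} [Fintype α] {w : α → MvPolynomial σ k}
    (hw : ∀ i, w i ∈ L) (f : α → MvPolynomial (Fin p) k) :
    ψ (comb y w f) = ∑ i, f i * ψ (w i) := by
  rw [comb, hψ.map_sum _ _ fun i => L.mul_mem_left _ (hw i)]
  exact Finset.sum_congr rfl fun i _ => hψ.map_smul _ _ (hw i)

lemma map_sub (hψ : IsLinearForm y L N ψ) {u v : MvPolynomial σ k} (hu : u ∈ L) (hv : v ∈ L) :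
    ψ (u - v) = ψ u - ψ v := by
  have := hψ.map_add (u - v) (L.sub_mem hu hv) v hv
  rw [sub_add_cancel] at this
  rw [this]; ring

/-- This moves a form on `L / N` to the whole of `S / N`, where a perfect form can represent it. -/
lemma mul_left (hψ : IsLinearForm y L N ψ) {x : MvPolynomial σ k} (hx : x ∈ L) :
    IsLinearForm y ⊤ N (fun u => ψ (x * u)) where
  map_add u _ v _ := by
    rw [mul_add]
    exact hψ.map_add _ (L.mul_mem_right _ hx) _ (L.mul_mem_right _ hx)
  map_smul r u _ := by
    rw [mul_left_comm]
    exact hψ.map_smul _ _ (L.mul_mem_right _ hx)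
  map_eq_zero u hu := hψ.map_eq_zero _ (N.mul_mem_left _ hu)

end IsLinearForm

end Coordinates

/-! ### The perfect pairing on `A` and the dual of a linked ideal. -/

section Duality

variable {σ k : Type*} [Field k] {p : ℕ} {y : Fin p → MvPolynomial σ k}
  {L N : Ideal (MvPolynomial σ k)}

lemma isUnit_of_isHomogeneous {τ : Type*} {f : MvPolynomial τ k} {e : ℕ} (hf : f.IsHomogeneous e)
    (h0 : constantCoeff f ≠ 0) : IsUnit f := by
  have he : e = 0 := by
    by_contra hne
    exact h0 (mem_idealOfVars_iff.1 (mem_idealOfVars_of_isHomogeneous hf hne))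
  subst he
  have := homogeneousComponent_eq_self hf
  rw [homogeneousComponent_zero] at this
  rw [← this]
  exact (isUnit_iff_ne_zero.2 h0).map C

/-- All terms of the Leibniz expansion have the same degree, so the determinant is homogeneous;
having a nonzero constant term, it is a nonzero constant. -/
lemma isUnit_det_of_isHomogeneous {τ : Type*} {d : ℕ} {G : Matrix (Fin d) (Fin d) (MvPolynomial τ k)}
    {μ : Fin d → ℕ} {c : ℕ} (hG : ∀ i j, c ≤ μ i + μ j → (G i j).IsHomogeneous (μ i + μ j - c))
    (hG0 : ∀ i j, μ i + μ j < c → G i j = 0) (hdet : constantCoeff G.det ≠ 0) : IsUnit G.det := by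
  refine isUnit_of_isHomogeneous (e := 2 * ∑ i, μ i - d * c) ?_ hdet
  rw [Matrix.det_apply]
  refine IsHomogeneous.sum _ _ _ fun π _ => ?_
  have hprod : (∏ i, G (π i) i).IsHomogeneous (2 * ∑ i, μ i - d * c) := by
    -- Truncated subtraction is harmless: a permutation with a factor of negative expected degree
    -- contributes zero.
    by_cases h : ∃ i, μ (π i) + μ i < c
    · obtain ⟨i, hi⟩ := h
      rw [Finset.prod_eq_zero (f := fun i => G (π i) i) (Finset.mem_univ i) (hG0 _ _ hi)]
      exact isHomogeneous_zero _ _ _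
    · push Not at h
      have h1 := IsHomogeneous.prod Finset.univ (fun i => G (π i) i) _ fun i _ => hG _ _ (h i)
      convert! h1 using 1
      have h2 : ∑ i, (μ (π i) + μ i - c) + d * c = 2 * ∑ i, μ i := by
        have h3 : d * c = ∑ _i : Fin d, c := by simp
        rw [h3, ← Finset.sum_add_distrib, Finset.sum_congr rfl fun i _ => Nat.sub_add_cancel (h i),
          Finset.sum_add_distrib, Equiv.sum_comp π μ]
        ring
      omega
  rcases Int.units_eq_one_or (Equiv.Perm.sign π) with h | h <;> rw [h]
  · simpa using hprod
  · simpa using hprod.neg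

/-- A homogeneous `k[y]`-linear form `φ` of degree `-c` on `A = S / N` such that
`(u, v) ↦ φ (u v)` is a perfect pairing. -/
structure IsPerfectForm (y : Fin p → MvPolynomial σ k) (N : Ideal (MvPolynomial σ k)) (c : ℕ)
    (φ : MvPolynomial σ k → MvPolynomial (Fin p) k) : Prop where
  isLinearForm : IsLinearForm y ⊤ N φ
  nondegenerate : ∀ x, (∀ u, φ (x * u) = 0) → x ∈ N
  exists_eq : ∀ ψ, IsLinearForm y ⊤ N ψ → ∃ x, ∀ u, ψ u = φ (x * u)
  homogeneousComponent : ∀ t u, φ (homogeneousComponent t u) =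
    if c ≤ t then MvPolynomial.homogeneousComponent (t - c) (φ u) else 0

section Socle

variable {d : ℕ} {a : Fin d → MvPolynomial σ k} (ha : IsRelBasis y ⊤ N a)

include ha

/-- Together with `sub_sum_mem`, this identifies the constant terms of the coordinates with the
coordinates over `k` in `A / (y)`. -/
lemma IsRelBasis.constantCoeff_coords_eq_zero {u : MvPolynomial σ k}
    (hu : u ∈ N ⊔ Ideal.span (Set.range y)) (i : Fin d) :
    constantCoeff (coords y a N u i) = 0 := by
  have hlin := ha.isLinearForm_coords i
  obtain ⟨v, hv, w, hw, rfl⟩ := Submodule.mem_sup.1 hu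
  rw [hlin.map_add v trivial w trivial, hlin.map_eq_zero v hv, zero_add]
  obtain ⟨c, rfl⟩ := Ideal.mem_span_range_iff_exists_fun.1 hw
  rw [hlin.map_sum _ _ fun _ => trivial, map_sum]
  refine Finset.sum_eq_zero fun j _ => ?_
  have := hlin.map_smul (X j) (c j) trivial
  rw [aeval_X, mul_comm] at this
  rw [this, map_mul, constantCoeff_X, zero_mul]

lemma IsRelBasis.sub_sum_mem (u : MvPolynomial σ k) :
    u - ∑ i, C (constantCoeff (coords y a N u i)) * a i ∈ N ⊔ Ideal.span (Set.range y) := by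
  have h := ha.sub_comb_coords_mem (u := u) trivial
  have h1 : u - ∑ i, C (constantCoeff (coords y a N u i)) * a i = (u - comb y a (coords y a N u)) +
      ∑ i, (aeval y (coords y a N u i) - C (constantCoeff (coords y a N u i))) * a i := by
    simp_rw [sub_mul]
    rw [Finset.sum_sub_distrib, comb]
    ring
  rw [h1]
  exact Submodule.add_mem_sup h
    (Ideal.sum_mem _ fun i _ => Ideal.mul_mem_right _ _ (aeval_sub_C_mem y _))

/-- Above the top degree of the basis, the coordinates of a homogeneous element have positive
degree, so they vanish in `A / (y)`. -/
lemma IsRelBasis.mem_of_isHomogeneous (hy : ∀ i, (y i).IsHomogeneous 1) (hN : IsHomog N)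
    {μ : Fin d → ℕ} (hμ : ∀ i, (a i).IsHomogeneous (μ i)) {u : MvPolynomial σ k} {t : ℕ}
    (hu : u.IsHomogeneous t) (ht : ∀ i, μ i < t) : u ∈ N ⊔ Ideal.span (Set.range y) := by
  have h := ha.sub_sum_mem u
  rwa [Finset.sum_eq_zero, sub_zero] at h
  intro i _
  have h1 := ha.coords_homogeneousComponent hy hN hμ (u := u) trivial t i
  rw [homogeneousComponent_eq_self hu, if_pos (ht i).le] at h1
  have h2 : constantCoeff (coords y a N u i) = 0 := by
    rw [← mem_idealOfVars_iff, h1]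
    exact mem_idealOfVars_of_isHomogeneous (homogeneousComponent_isHomogeneous _ _)
      (by have := ht i; omega)
  rw [h2, C_0, zero_mul]

/-- If the socle of `A / (y)` is at most one-dimensional then the top coordinate defines a
nondegenerate pairing on `A / (y)`. -/
lemma IsRelBasis.exists_constantCoeff_coords_ne_zero (hy : ∀ i, (y i).IsHomogeneous 1)
    (hN : IsHomog N) {μ : Fin d → ℕ} (hμ : ∀ i, (a i).IsHomogeneous (μ i)) {ℓ : Fin d}
    (hℓ : ∀ i, μ i ≤ μ ℓ)
    (hsoc : ∀ u v : MvPolynomial σ k,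
      (∀ w ∈ idealOfVars σ k, w * u ∈ N ⊔ Ideal.span (Set.range y)) →
      (∀ w ∈ idealOfVars σ k, w * v ∈ N ⊔ Ideal.span (Set.range y)) →
      ∃ b c, (b ∉ idealOfVars σ k ∨ c ∉ idealOfVars σ k) ∧
        b * u + c * v ∈ N ⊔ Ideal.span (Set.range y))
    {x : MvPolynomial σ k} (hx : x ∉ N ⊔ Ideal.span (Set.range y)) :
    ∃ u, constantCoeff (coords y a N (x * u) ℓ) ≠ 0 := by
  set Q := N ⊔ Ideal.span (Set.range y) with hQ
  have hlin := ha.isLinearForm_coords ℓ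
  have hvars : ∀ u : MvPolynomial σ k, (∀ i, X i * u ∈ Q) → ∀ w ∈ idealOfVars σ k, w * u ∈ Q := by
    intro u hu w hw
    have : idealOfVars σ k ≤ Submodule.colon Q {u} := by
      rw [idealOfVars, Ideal.span_le]
      rintro _ ⟨i, rfl⟩
      exact Submodule.mem_colon_singleton.2 (hu i)
    exact Submodule.mem_colon_singleton.1 (this hw)
  -- A nonzero class is multiplied by variables as long as it stays nonzero; it ends in the socle,
  -- because all forms of some degree kill it.
  have hsocle : ∀ (t : ℕ) (x : MvPolynomial σ k), x ∉ Q →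
      (∀ f : MvPolynomial σ k, f.IsHomogeneous t → f * x ∈ Q) →
      ∃ u, x * u ∉ Q ∧ ∀ w ∈ idealOfVars σ k, w * (x * u) ∈ Q := by
    intro t
    induction t with
    | zero =>
      intro x hx h
      exact absurd (by simpa using h 1 (isHomogeneous_one _ _)) hx
    | succ t ih =>
      intro x hx h
      by_cases hX : ∀ i, X i * x ∈ Q
      · exact ⟨1, by rwa [mul_one], by rw [mul_one]; exact hvars x hX⟩
      · push Not at hX
        obtain ⟨i, hi⟩ := hX
        obtain ⟨u, hu, hu'⟩ := ih (X i * x) hi fun f hf => by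
          rw [← mul_assoc]
          exact h _ (hf.mul (isHomogeneous_X k i))
        refine ⟨X i * u, ?_⟩
        have : X i * x * u = x * (X i * u) := by ring
        rw [this] at hu hu'
        exact ⟨hu, hu'⟩
  obtain ⟨u, hu, hu'⟩ := hsocle (μ ℓ + 1) x hx fun f hf => Q.mul_mem_right _
    (ha.mem_of_isHomogeneous hy hN hμ hf fun i => Nat.lt_succ_of_le (hℓ i))
  refine ⟨u, fun hzero => ?_⟩
  -- Being of top degree, `a ℓ` represents a socle element.
  have haℓ : ∀ w ∈ idealOfVars σ k, w * a ℓ ∈ Q := hvars _ fun i =>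
    ha.mem_of_isHomogeneous hy hN hμ ((isHomogeneous_X k i).mul (hμ ℓ)) fun j => by
      have := hℓ j; omega
  have hsplit : ∀ b v : MvPolynomial σ k, (∀ w ∈ idealOfVars σ k, w * v ∈ Q) →
      b * v - C (constantCoeff b) * v ∈ Q := by
    intro b v hv
    rw [← sub_mul]
    exact hv _ (mem_idealOfVars_iff.2 (by simp))
  -- The socle elements `x u` and `a ℓ` are dependent. If the top coordinate of `x u` had zero
  -- constant term, the coefficient of `a ℓ` would vanish, and `x u` would lie in `Q`.
  obtain ⟨b, c, hbc, hmem⟩ := hsoc _ _ hu' haℓ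
  have hmem' : C (constantCoeff b) * (x * u) + C (constantCoeff c) * a ℓ ∈ Q := by
    have : C (constantCoeff b) * (x * u) + C (constantCoeff c) * a ℓ = (b * (x * u) + c * a ℓ) -
      ((b * (x * u) - C (constantCoeff b) * (x * u)) + (c * a ℓ - C (constantCoeff c) * a ℓ)) := by
      ring
    rw [this]
    exact Q.sub_mem hmem (Q.add_mem (hsplit _ _ hu') (hsplit _ _ haℓ))
  have hC : ∀ (z : k) v, coords y a N (C z * v) ℓ = C z * coords y a N v ℓ := by
    intro z v
    have := hlin.map_smul (C z) v trivial
    rwa [aeval_C, algebraMap_eq] at this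
  have h1 := ha.constantCoeff_coords_eq_zero hmem' ℓ
  have h2 := hlin.map_add (C (constantCoeff b) * (x * u)) trivial (C (constantCoeff c) * a ℓ) trivial
  simp only [hC, ha.coords_apply_self, Pi.single_eq_same, mul_one] at h2
  rw [h2, map_add, map_mul, hzero, mul_zero, zero_add, constantCoeff_C] at h1
  have hb : constantCoeff b ≠ 0 := by
    rcases hbc with hb | hc
    · exact fun h => hb (mem_idealOfVars_iff.2 h)
    · exact absurd (mem_idealOfVars_iff.2 h1) hc
  rw [h1, C_0, zero_mul, add_zero] at hmem'
  apply hu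
  have : x * u = C (constantCoeff b)⁻¹ * (C (constantCoeff b) * (x * u)) := by
    rw [← mul_assoc, ← C_mul, inv_mul_cancel₀ hb, C_1, one_mul]
  rw [this]
  exact Q.mul_mem_left _ hmem'

/-- The Gram matrix of the top coordinate is invertible modulo `(y)` by nondegeneracy on `A / (y)`,
hence over `k[y]` by homogeneity. Its inverse then yields both nondegeneracy and representability.
-/
lemma IsRelBasis.isPerfectForm (hy : ∀ i, (y i).IsHomogeneous 1) (hN : IsHomog N) {μ : Fin d → ℕ}
    (hμ : ∀ i, (a i).IsHomogeneous (μ i)) {ℓ : Fin d} (hℓ : ∀ i, μ i ≤ μ ℓ)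
    (hsoc : ∀ u v : MvPolynomial σ k,
      (∀ w ∈ idealOfVars σ k, w * u ∈ N ⊔ Ideal.span (Set.range y)) →
      (∀ w ∈ idealOfVars σ k, w * v ∈ N ⊔ Ideal.span (Set.range y)) →
      ∃ b c, (b ∉ idealOfVars σ k ∨ c ∉ idealOfVars σ k) ∧
        b * u + c * v ∈ N ⊔ Ideal.span (Set.range y)) :
    IsPerfectForm y N (μ ℓ) (fun u => coords y a N u ℓ) := by
  have hlin := ha.isLinearForm_coords ℓ
  have hhom := fun t (u : MvPolynomial σ k) =>
    ha.coords_homogeneousComponent hy hN hμ (u := u) trivial t ℓ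
  let G : Matrix (Fin d) (Fin d) (MvPolynomial (Fin p) k) :=
    Matrix.of fun i j => coords y a N (a i * a j) ℓ
  have hcombG : ∀ f j, coords y a N (comb y a f * a j) ℓ = Matrix.vecMul f G j := by
    intro f j
    have : comb y a f * a j = comb y (fun i => a i * a j) f := by
      rw [comb, comb, Finset.sum_mul]
      exact Finset.sum_congr rfl fun i _ => mul_assoc _ _ _
    rw [this, hlin.map_comb fun _ => trivial]
    rfl
  have hdet : IsUnit G.det := by
    have hself : ∀ i j, G i j = if μ ℓ ≤ μ i + μ j then
        MvPolynomial.homogeneousComponent (μ i + μ j - μ ℓ) (G i j) else 0 := by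
      intro i j
      have := hhom (μ i + μ j) (a i * a j)
      rwa [homogeneousComponent_eq_self ((hμ i).mul (hμ j))] at this
    refine isUnit_det_of_isHomogeneous (μ := μ) (c := μ ℓ) (fun i j h => ?_) (fun i j h => ?_) ?_
    · rw [hself, if_pos h]
      exact homogeneousComponent_isHomogeneous _ _
    · rw [hself, if_neg (by omega)]
    · rw [RingHom.map_det]
      intro hzero
      obtain ⟨v, hv, hGv⟩ := Matrix.exists_vecMul_eq_zero_iff.2 hzero
      have hx : comb y a (fun i => C (v i)) ∉ N ⊔ Ideal.span (Set.range y) := by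
        intro hmem
        apply hv
        funext i
        have := ha.constantCoeff_coords_eq_zero hmem i
        rwa [ha.coords_eq (f := fun i => C (v i)) (by rw [sub_self]; exact N.zero_mem),
          constantCoeff_C] at this
      obtain ⟨u, hu⟩ := ha.exists_constantCoeff_coords_ne_zero hy hN hμ hℓ hsoc hx
      apply hu
      -- Only the class of `u` modulo `(y)` matters, so `u` is replaced by a `k`-combination of the
      -- `a j`, which the kernel vector `v` annihilates.
      have h1 := ha.constantCoeff_coords_eq_zero
        (Ideal.mul_mem_left _ (comb y a fun i => C (v i)) (ha.sub_sum_mem u)) ℓ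
      rw [mul_sub, hlin.map_sub trivial trivial, map_sub, sub_eq_zero] at h1
      rw [h1, Finset.mul_sum, hlin.map_sum _ _ fun _ => trivial, map_sum]
      refine Finset.sum_eq_zero fun j _ => ?_
      have h2 := hlin.map_smul (C (constantCoeff (coords y a N u j)))
        (comb y a (fun i => C (v i)) * a j) trivial
      rw [aeval_C, algebraMap_eq] at h2
      rw [mul_left_comm, h2, hcombG, map_mul]
      have h3 : constantCoeff (Matrix.vecMul (fun i => C (v i)) G j) =
          Matrix.vecMul v (constantCoeff.mapMatrix G) j := by
        simp [Matrix.vecMul, dotProduct]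
      rw [h3, hGv]
      simp
  refine ⟨hlin, fun x hx => ?_, fun ψ hψ => ?_, hhom⟩
  · have hmem := ha.sub_comb_coords_mem (u := x) trivial
    have h0 : Matrix.vecMul (coords y a N x) G = 0 := by
      funext j
      rw [← hcombG, ← hlin.map_congr le_top trivial (u := x * a j)]
      · exact hx (a j)
      · rw [← sub_mul]
        exact N.mul_mem_right _ hmem
    have h1 : coords y a N x = 0 := by
      have := congrArg (fun f => Matrix.vecMul f G⁻¹) h0
      simpa [Matrix.vecMul_vecMul, Matrix.mul_nonsing_inv _ hdet] using this
    rwa [h1, comb_zero, sub_zero] at hmem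
  · let f := Matrix.vecMul (fun j => ψ (a j)) G⁻¹
    have hf : Matrix.vecMul f G = fun j => ψ (a j) := by
      simp [f, Matrix.vecMul_vecMul, Matrix.nonsing_inv_mul _ hdet]
    refine ⟨comb y a f, fun u => ?_⟩
    have hmem := ha.sub_comb_coords_mem (u := u) trivial
    have h1 := (hlin.mul_left (x := comb y a f) trivial)
    rw [hψ.map_congr le_top trivial hmem, hψ.map_comb fun _ => trivial]
    refine Eq.trans ?_ (h1.map_congr le_top trivial hmem).symm
    rw [h1.map_comb fun _ => trivial]
    refine Finset.sum_congr rfl fun j _ => ?_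
    rw [hcombG, hf]

end Socle

/-- Duality: if `L' = (N + (h)) : L` then `L' / N` is a twist of the `k[y]`-dual of `L / N`. -/
theorem IsRelBasis.exists_dual {c s d : ℕ} {φ : MvPolynomial σ k → MvPolynomial (Fin p) k}
    (hφ : IsPerfectForm y N c φ) (hy : ∀ i, (y i).IsHomogeneous 1) (hN : IsHomog N)
    {L' : Ideal (MvPolynomial σ k)} (hNL' : N ≤ L')
    {h : MvPolynomial σ k} (hh : h.IsHomogeneous s) (hhL : h ∈ L)
    (hmul : ∀ x ∈ L, ∀ w ∈ L', ∃ q, w * x - h * q ∈ N)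
    (hcolon : ∀ w, (∀ x ∈ L, ∃ q, w * x - h * q ∈ N) → w ∈ L')
    (hreg : ∀ u, h * u ∈ N → u ∈ N) {z : MvPolynomial σ k} (hzL : z ∈ L)
    (hz : ∀ u, z * u ∈ N → u ∈ N) {g : Fin d → MvPolynomial σ k} (hb : IsRelBasis y L N g)
    {ν : Fin d → ℕ} (hg : ∀ i, (g i).IsHomogeneous (ν i)) :
    ∃ g' : Fin d → MvPolynomial σ k, IsRelBasis y L' N g' ∧
      ∀ i, ν i ≤ c + s ∧ (g' i).IsHomogeneous (c + s - ν i) := by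
  have hlin := hφ.isLinearForm
  -- For `x ∈ L`, the element `D i x` represents through `φ` the form `u ↦` `i`-th coordinate of `x
  -- u`; outside `L` the value is irrelevant.
  have hrep : ∀ (i : Fin d) (x : MvPolynomial σ k), ∃ w, x ∈ L →
      ∀ u, coords y g N (x * u) i = φ (w * u) := by
    intro i x
    by_cases hx : x ∈ L
    · obtain ⟨w, hw⟩ := hφ.exists_eq _ ((hb.isLinearForm_coords i).mul_left hx)
      exact ⟨w, fun _ => hw⟩
    · exact ⟨0, fun h => absurd h hx⟩
  choose D hD using hrep
  have hD1 : ∀ i j, φ (D i (g j)) = Pi.single (M := fun _ => MvPolynomial (Fin p) k) j 1 i := by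
    intro i j
    have := hD i (g j) (hb.mem j) 1
    rw [mul_one, mul_one, hb.coords_apply_self] at this
    exact this.symm
  -- Both products represent `u ↦` `i`-th coordinate of `h x u`. So `D i` is multiplication by the
  -- fraction `D i h / h`, and the `D i h` are the candidates for the dual basis.
  have hDh : ∀ i, ∀ x ∈ L, D i h * x - h * D i x ∈ N := by
    intro i x hx
    refine hφ.nondegenerate _ fun u => ?_
    have h1 : (D i h * x - h * D i x) * u = D i h * (x * u) - D i x * (h * u) := by ring
    rw [h1, hlin.map_sub trivial trivial, ← hD i h hhL, ← hD i x hx, mul_left_comm, sub_self]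
  have hwL' : ∀ i, D i h ∈ L' := fun i => hcolon _ fun x hx => ⟨D i x, hDh i x hx⟩
  have hcombD : ∀ f, ∀ x ∈ L,
      comb y (fun i => D i h) f * x - h * comb y (fun i => D i x) f ∈ N := by
    intro f x hx
    have h1 : comb y (fun i => D i h) f * x - h * comb y (fun i => D i x) f =
        ∑ i, aeval y (f i) * (D i h * x - h * D i x) := by
      rw [comb, comb, Finset.sum_mul, Finset.mul_sum, ← Finset.sum_sub_distrib]
      exact Finset.sum_congr rfl fun i _ => by ring
    rw [h1]
    exact Ideal.sum_mem _ fun i _ => N.mul_mem_left _ (hDh i x hx)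
  have hφD : ∀ f j, φ (comb y (fun i => D i (g j)) f) = f j := by
    intro f j
    rw [hlin.map_comb fun _ => trivial]
    simp_rw [hD1]
    simp [Pi.single_apply]
  have hbasis : IsRelBasis y L' N (fun i => D i h) := by
    refine ⟨hwL', fun w hw => ?_, fun f hf => ?_⟩
    -- With `q j = w (g j) / h`, the coefficients of `w` must be the values `φ (q j)` of the form `x
    -- ↦ φ(wx/h)` on the basis.
    · choose q hq using fun j => hmul (g j) (hb.mem j) w hw
      refine ⟨fun j => φ (q j), ?_⟩
      set f : Fin d → MvPolynomial (Fin p) k := fun j => φ (q j)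
      set v := w - comb y (fun i => D i h) f with hv
      let q' : Fin d → MvPolynomial σ k := fun j => q j - comb y (fun i => D i (g j)) f
      have hq' : ∀ j, v * g j - h * q' j ∈ N := by
        intro j
        have h1 : v * g j - h * q' j = (w * g j - h * q j) -
            (comb y (fun i => D i h) f * g j - h * comb y (fun i => D i (g j)) f) := by
          simp only [hv, q']; ring
        rw [h1]
        exact N.sub_mem (hq j) (hcombD f _ (hb.mem j))
      have hφq' : ∀ j, φ (q' j) = 0 := by
        intro j
        rw [hlin.map_sub trivial trivial, hφD, sub_self]
      -- The difference `v` induces the zero form `x ↦ φ(vx/h)` on `L`.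
      have hvx : ∀ x ∈ L, ∃ r, v * x - h * r ∈ N ∧ φ r = 0 := by
        intro x hx
        refine ⟨comb y q' (coords y g N x), ?_, ?_⟩
        · have h1 : v * x - h * comb y q' (coords y g N x) =
              v * (x - comb y g (coords y g N x)) +
                ∑ j, aeval y (coords y g N x j) * (v * g j - h * q' j) := by
            simp_rw [mul_sub, Finset.sum_sub_distrib, comb, Finset.mul_sum, mul_left_comm (aeval y _)]
            ring
          rw [h1]
          exact N.add_mem (N.mul_mem_left _ (hb.sub_comb_coords_mem hx))
            (Ideal.sum_mem _ fun j _ => N.mul_mem_left _ (hq' j))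
        · rw [hlin.map_comb fun _ => trivial]
          exact Finset.sum_eq_zero fun j _ => by rw [hφq', mul_zero]
      -- For `r = vz/h`, applying this to every `z u` gives `φ (r u) = 0`. Nondegeneracy puts `r` in
      -- `N`, and cancelling `z` puts `v` in `N`.
      obtain ⟨r, hr, -⟩ := hvx z hzL
      have hrN : r ∈ N := by
        refine hφ.nondegenerate _ fun u => ?_
        obtain ⟨r', hr', hφr'⟩ := hvx (z * u) (L.mul_mem_right _ hzL)
        rw [← hφr']
        refine hlin.map_congr le_top trivial (hreg _ ?_)
        have h1 : h * (r * u - r') = (v * (z * u) - h * r') - (v * z - h * r) * u := by ring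
        rw [h1]
        exact N.sub_mem hr' (N.mul_mem_right _ hr)
      refine hz _ ?_
      have h1 : z * v = (v * z - h * r) + h * r := by ring
      rw [h1]
      exact N.add_mem hr (N.mul_mem_left _ hrN)
    · funext j
      have h1 : comb y (fun i => D i (g j)) f ∈ N := by
        refine hreg _ ?_
        have h2 : h * comb y (fun i => D i (g j)) f = comb y (fun i => D i h) f * g j -
            (comb y (fun i => D i h) f * g j - h * comb y (fun i => D i (g j)) f) := by ring
        rw [h2]
        exact N.sub_mem (N.mul_mem_right _ hf) (hcombD f _ (hb.mem j))
      rw [← hφD f j, hlin.map_eq_zero _ h1]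
      rfl
  -- Comparing degrees in `φ (D i h * u)` and the `i`-th coordinate of `h u`: the first lowers
  -- degrees by `c`, the second shifts them by `s - ν i`, so modulo `N` only degree `c + s - ν i`
  -- survives in `D i h`.
  have hcomp : ∀ i t, t + ν i ≠ c + s → homogeneousComponent t (D i h) ∈ N := by
    intro i t ht
    refine hφ.nondegenerate _ fun u => ?_
    rw [← sum_homogeneousComponent u, Finset.mul_sum, hlin.map_sum _ _ fun _ => trivial]
    refine Finset.sum_eq_zero fun e _ => ?_
    have hue := homogeneousComponent_isHomogeneous e u
    set v := homogeneousComponent e u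
    have h1 : homogeneousComponent t (D i h) * v = homogeneousComponent (t + e) (D i h * v) := by
      rw [homogeneousComponent_mul_of_isHomogeneous hue, if_pos (Nat.le_add_left e t),
        Nat.add_sub_cancel]
    have h2 := hb.coords_homogeneousComponent hy hN hg (L.mul_mem_right v hhL) (s + e) i
    rw [homogeneousComponent_eq_self (hh.mul hue), hD i h hhL] at h2
    rw [h1, hφ.homogeneousComponent, h2]
    split_ifs with h3 h4
    · rw [homogeneousComponent_of_mem (homogeneousComponent_mem _ _), if_neg (by omega)]
    · rw [map_zero]
    · rfl
  have hle : ∀ i, ν i ≤ c + s := by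
    intro i
    by_contra hlt
    have h1 : D i h ∈ N := by
      rw [← sum_homogeneousComponent (D i h)]
      exact Ideal.sum_mem _ fun t _ => hcomp i t (by omega)
    have h2 := hbasis.indep (Pi.single i 1) (by rw [comb_single]; exact N.mul_mem_left _ h1)
    exact one_ne_zero (α := MvPolynomial (Fin p) k) (by simpa using congrFun h2 i)
  refine ⟨fun i => homogeneousComponent (c + s - ν i) (D i h), hbasis.congr hNL' fun i => ?_,
    fun i => ⟨hle i, homogeneousComponent_isHomogeneous _ _⟩⟩
  have h1 : homogeneousComponent (c + s - ν i) (D i h - homogeneousComponent (c + s - ν i) (D i h))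
      = 0 := by
    rw [map_sub, homogeneousComponent_eq_self (homogeneousComponent_isHomogeneous _ _), sub_self]
  rw [← sum_homogeneousComponent (D i h - homogeneousComponent (c + s - ν i) (D i h))]
  refine Ideal.sum_mem _ fun t _ => ?_
  by_cases ht : t = c + s - ν i
  · rw [ht, h1]; exact N.zero_mem
  · rw [map_sub, homogeneousComponent_of_mem (homogeneousComponent_mem (c + s - ν i) _), if_neg ht,
      sub_zero]
    exact hcomp i t (by have := hle i; omega)

end Duality

end ProjACM

namespace ProjACM

open MvPolynomial CategoryTheory

/-! ### Ranks over `k[y]` and nonzerodivisors. -/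

section Rank

variable {σ k : Type*} [Field k] {p : ℕ} {y : Fin p → MvPolynomial σ k}
  {L L' N : Ideal (MvPolynomial σ k)}

/-- Multiplication by the nonzerodivisor `z` embeds one free `k[y]`-module in the other. -/
lemma IsRelBasis.card_le {d d' : ℕ} {g : Fin d → MvPolynomial σ k} {g' : Fin d' → MvPolynomial σ k}
    (hb : IsRelBasis y L N g) (hb' : IsRelBasis y L' N g') {z : MvPolynomial σ k}
    (hzL : ∀ u ∈ L, z * u ∈ L') (hz : ∀ u, z * u ∈ N → u ∈ N) : d ≤ d' := by
  have hlin := hb'.isLinearForm_coords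
  let F : (Fin d → MvPolynomial (Fin p) k) →ₗ[MvPolynomial (Fin p) k]
      (Fin d' → MvPolynomial (Fin p) k) :=
    { toFun := fun f => coords y g' N (z * comb y g f)
      map_add' := fun f f' => by
        funext i
        rw [comb_add, mul_add]
        exact (hlin i).map_add _ (hzL _ (comb_mem hb.mem f)) _ (hzL _ (comb_mem hb.mem f'))
      map_smul' := fun r f => by
        funext i
        rw [comb_smul, mul_left_comm]
        exact (hlin i).map_smul _ _ (hzL _ (comb_mem hb.mem f)) }
  have hF : Function.Injective F := by
    rw [injective_iff_map_eq_zero]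
    intro f hf
    have h1 := hb'.sub_comb_coords_mem (hzL _ (comb_mem (y := y) hb.mem f))
    rw [show coords y g' N (z * comb y g f) = 0 from hf, comb_zero, sub_zero] at h1
    exact hb.indep f (hz _ h1)
  simpa using card_le_of_injective _ F hF

lemma IsRelBasis.reindex {ι κ : Type*} [Fintype ι] [Fintype κ] {g : ι → MvPolynomial σ k}
    (hb : IsRelBasis y L N g) (ε : κ ≃ ι) : IsRelBasis y L N (g ∘ ε) := by
  have hcomb : ∀ f, comb y (g ∘ ε) f = comb y g (f ∘ ε.symm) := by
    intro f
    rw [comb, comb, ← Equiv.sum_comp ε]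
    simp
  refine ⟨fun i => hb.mem _, fun u hu => ?_, fun f hf => ?_⟩
  · obtain ⟨f, hf⟩ := hb.span u hu
    refine ⟨f ∘ ε, ?_⟩
    rw [hcomb]
    convert! hf
    funext i
    simp
  · rw [hcomb] at hf
    have := hb.indep _ hf
    funext i
    simpa using congrFun this (ε i)

lemma IsRelBasis.regular_aeval {d : ℕ} {a : Fin d → MvPolynomial σ k} (ha : IsRelBasis y ⊤ N a)
    {f : MvPolynomial (Fin p) k} (hf : f ≠ 0) (u : MvPolynomial σ k) (hu : aeval y f * u ∈ N) :
    u ∈ N := by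
  have h1 := ha.sub_comb_coords_mem (u := u) trivial
  have h2 : comb y a (f • coords y a N u) ∈ N := by
    rw [comb_smul]
    have : aeval y f * comb y a (coords y a N u) =
      aeval y f * u - aeval y f * (u - comb y a (coords y a N u)) := by ring
    rw [this]
    exact N.sub_mem hu (N.mul_mem_left _ h1)
  have h3 := (smul_eq_zero.1 (ha.indep _ h2)).resolve_left hf
  rwa [h3, comb_zero, sub_zero] at h1

/-- If `S / N` is finite over `k[y]` then some nonzero polynomial in `y, x` lies in `N`. -/
lemma IsRelBasis.exists_aeval_snoc_mem {d : ℕ} {a : Fin d → MvPolynomial σ k}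
    (ha : IsRelBasis y ⊤ N a) (x : MvPolynomial σ k) :
    ∃ f : MvPolynomial (Fin (p + 1)) k, f ≠ 0 ∧
      aeval (Fin.snoc (α := fun _ => MvPolynomial σ k) y x) f ∈ N := by
  -- The `d + 1` powers `1, x, …, x^d` are dependent in a free module of rank `d`.
  have hdep : ¬ LinearIndependent (MvPolynomial (Fin p) k)
      (fun j : Fin (d + 1) => coords y a N (x ^ (j : ℕ))) := by
    intro h
    have := h.fintype_card_le_finrank
    simp at this
  rw [Fintype.not_linearIndependent_iff] at hdep
  obtain ⟨r, hr, i, hi⟩ := hdep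
  refine ⟨∑ j : Fin (d + 1), rename Fin.castSucc (r j) * X (Fin.last p) ^ (j : ℕ), ?_, ?_⟩
  -- Viewed as a polynomial in the last variable, the relation has `r i ≠ 0` as its coefficient of
  -- index `i`.
  · intro hzero
    have h1 := congrArg (aeval (Fin.snoc (α := fun _ => Polynomial (MvPolynomial (Fin p) k))
      (fun i => Polynomial.C (X i)) Polynomial.X)) hzero
    have h2 : ∀ q : MvPolynomial (Fin p) k,
        aeval (fun i : Fin p => (Polynomial.C (X i) : Polynomial (MvPolynomial (Fin p) k))) q =
          Polynomial.C q := by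
      intro q
      induction q using MvPolynomial.induction_on with
      | C a => simp [IsScalarTower.algebraMap_apply k (MvPolynomial (Fin p) k), algebraMap_eq]
      | add q q' h h' => simp only [map_add, h, h']
      | mul_X q i h => simp only [map_mul, h, aeval_X]
    simp only [map_sum, map_mul, map_pow, aeval_rename, aeval_X, Fin.snoc_last, map_zero] at h1
    have h3 : (Fin.snoc (α := fun _ => Polynomial (MvPolynomial (Fin p) k))
        (fun i => Polynomial.C (X i)) Polynomial.X) ∘ Fin.castSucc =
        fun i : Fin p => (Polynomial.C (X i) : Polynomial (MvPolynomial (Fin p) k)) := by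
      funext i
      simp
    rw [h3] at h1
    simp_rw [h2] at h1
    have h4 := congrArg (fun q => Polynomial.coeff q (i : ℕ)) h1
    simp only [Polynomial.finsetSum_coeff, Polynomial.coeff_C_mul_X_pow, Polynomial.coeff_zero]
      at h4
    rw [Finset.sum_eq_single i] at h4
    · exact hi (by simpa using h4)
    · intro j _ hj
      rw [if_neg]
      exact fun h => hj (Fin.ext h.symm)
    · simp
  · have h1 : aeval (Fin.snoc (α := fun _ => MvPolynomial σ k) y x)
        (∑ j : Fin (d + 1), rename Fin.castSucc (r j) * X (Fin.last p) ^ (j : ℕ)) =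
        ∑ j : Fin (d + 1), aeval y (r j) * x ^ (j : ℕ) := by
      simp only [map_sum, map_mul, map_pow, aeval_rename, aeval_X, Fin.snoc_last]
      refine Finset.sum_congr rfl fun j _ => ?_
      congr 3
      funext i
      simp
    rw [h1]
    have h2 := ha.sub_comb_coords_mem (u := ∑ j : Fin (d + 1), aeval y (r j) * x ^ (j : ℕ)) trivial
    have h3 : coords y a N (∑ j : Fin (d + 1), aeval y (r j) * x ^ (j : ℕ)) = 0 := by
      rw [← hr]
      funext l
      have hlin := ha.isLinearForm_coords l
      refine (hlin.map_sum _ _ fun _ => trivial).trans ?_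
      rw [Finset.sum_apply]
      exact Finset.sum_congr rfl fun j _ => hlin.map_smul _ _ trivial
    rwa [h3, comb_zero, sub_zero] at h2

end Rank

/-! ### Arithmetically Cohen–Macaulay schemes and their hypersurfaces. -/

section ACM

variable {k : Type*} [Field k] {n m : ℕ} {IX IY : Ideal (MvPolynomial (Fin (n + 1)) k)}

lemma IsACM.isHomog (h : IsACM m IX) : IsHomog IX := h.homogeneousComponent_mem

lemma sup_span_ne_top {p : ℕ} {y : Fin p → MvPolynomial (Fin (n + 1)) k} (hX : IsACM m IX)
    (hy : ∀ i, (y i).IsHomogeneous 1) : IX ⊔ Ideal.span (Set.range y) ≠ ⊤ := by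
  intro h
  apply idealOfVars_ne_top (σ := Fin (n + 1)) (k := k)
  rw [eq_top_iff, ← h]
  refine sup_le (le_idealOfVars_of_isHomogeneous hX.isHomog hX.ne_top) ?_
  rw [Ideal.span_le]
  rintro _ ⟨i, rfl⟩
  exact mem_idealOfVars_of_isHomogeneous (hy i) one_ne_zero

lemma isRegularLinearSystem_iff (hX : IsACM m IX) {p : ℕ}
    {y : Fin (p + 1) → MvPolynomial (Fin (n + 1)) k} :
    IsRegularLinearSystem IX y ↔ (∀ i, (y i).IsHomogeneous 1) ∧ RegOn ⊤ IX (List.ofFn y) := by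
  constructor
  · rintro ⟨h1, h2⟩
    exact ⟨h1, (isRegular_quotient_iff.1 h2).1⟩
  · rintro ⟨h1, h2⟩
    refine ⟨h1, isRegular_quotient_iff.2 ⟨h2, ?_⟩⟩
    rw [ofList_ofFn]
    exact sup_span_ne_top hX h1

lemma IsACM.finite_quotient (hX : IsACM m IX) {y : Fin (m + 1) → MvPolynomial (Fin (n + 1)) k}
    (hreg : RegOn ⊤ IX (List.ofFn y)) :
    Module.Finite k (MvPolynomial (Fin (n + 1)) k ⧸ (IX ⊔ Ideal.span (Set.range y))) := by
  rw [← ofList_ofFn]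
  refine hreg.finite_quotient ?_
  rw [hX.krullDim_eq, List.length_ofFn]

lemma IsACM.exists_isRelBasis_top (hX : IsACM m IX)
    {y : Fin (m + 1) → MvPolynomial (Fin (n + 1)) k} (hy : ∀ i, (y i).IsHomogeneous 1)
    (hreg : RegOn ⊤ IX (List.ofFn y)) :
    ∃ (d : ℕ) (e : Fin d → ℕ) (g : Fin d → MvPolynomial (Fin (n + 1)) k), Monotone e ∧
      (∀ i, (g i).IsHomogeneous (e i)) ∧ IsRelBasis y ⊤ IX g := by
  have := hX.finite_quotient hreg
  obtain ⟨r, s, hs⟩ := Module.Finite.exists_fin (R := k)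
    (M := MvPolynomial (Fin (n + 1)) k ⧸ (IX ⊔ Ideal.span (Set.range y)))
  choose u hu using fun i => Ideal.Quotient.mk_surjective (s i)
  obtain ⟨d, e, g, h1, h2, h3, -⟩ := exists_isRelBasis hy isHomog_top hX.isHomog hreg
    ⟨r, u, fun _ => trivial, fun x _ => by
      have hx : Ideal.Quotient.mk (IX ⊔ Ideal.span (Set.range y)) x ∈
        Submodule.span k (Set.range s) := by rw [hs]; trivial
      obtain ⟨c, hc⟩ := (Submodule.mem_span_range_iff_exists_fun k).1 hx
      refine ⟨c, ?_⟩
      rw [Ideal.mul_top, ← Ideal.Quotient.eq, ← hc, map_sum]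
      refine Finset.sum_congr rfl fun i _ => ?_
      rw [← hu i, ← smul_eq_C_mul]
      rfl⟩
  exact ⟨d, e, g, h1, h2, h3⟩

/-- For a Gorenstein ring `A`, the socle of `A / (y)` is at most one-dimensional. -/
lemma IsACM.exists_mul_add_mul_mem (hX : IsACM m IX) (hG : IsGorenstein IX)
    {y : Fin (m + 1) → MvPolynomial (Fin (n + 1)) k} (hy : ∀ i, (y i).IsHomogeneous 1)
    (hreg : RegOn ⊤ IX (List.ofFn y)) {d : ℕ} {a : Fin d → MvPolynomial (Fin (n + 1)) k}
    (ha : IsRelBasis y ⊤ IX a) {μ : Fin d → ℕ} (hμ : ∀ i, (a i).IsHomogeneous (μ i))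
    (u v : MvPolynomial (Fin (n + 1)) k)
    (hu : ∀ w ∈ idealOfVars (Fin (n + 1)) k, w * u ∈ IX ⊔ Ideal.span (Set.range y))
    (hv : ∀ w ∈ idealOfVars (Fin (n + 1)) k, w * v ∈ IX ⊔ Ideal.span (Set.range y)) :
    ∃ b c, (b ∉ idealOfVars (Fin (n + 1)) k ∨ c ∉ idealOfVars (Fin (n + 1)) k) ∧
      b * u + c * v ∈ IX ⊔ Ideal.span (Set.range y) := by
  obtain ⟨N, hN⟩ := hG
  set Q := IX ⊔ Ideal.span (Set.range y) with hQ
  set 𝔪 := idealOfVars (Fin (n + 1)) k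
  let π := Ideal.Quotient.mk IX
  have hπ : Function.Surjective π := Ideal.Quotient.mk_surjective
  have hIXm : IX ≤ 𝔪 := le_idealOfVars_of_isHomogeneous hX.isHomog hX.ne_top
  have hIXQ : IX ≤ Q := le_sup_left
  have hker : RingHom.ker π = IX := Ideal.mk_ker
  have hmem : ∀ (J : Ideal (MvPolynomial (Fin (n + 1)) k)), IX ≤ J → ∀ x, π x ∈ J.map π ↔ x ∈ J :=
    fun J hJ x => Ideal.mem_quotient_iff_mem hJ
  have hmax : (𝔪.map π).IsMaximal := by
    refine Ideal.map_eq_top_or_isMaximal_of_surjective π hπ inferInstance |>.resolve_left ?_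
    intro h
    apply idealOfVars_ne_top (σ := Fin (n + 1)) (k := k)
    rw [Ideal.eq_top_iff_one, ← hmem _ hIXm, h]
    trivial
  -- All monomials above the top degree of the basis lie in `Q`; hence `𝔪` is the only maximal ideal
  -- containing `Q`, as the dévissage requires.
  have hpow : 𝔪 ^ (Finset.univ.sup μ + 1) ≤ Q := by
    intro f hf
    rw [mem_pow_idealOfVars_iff] at hf
    rw [f.as_sum]
    refine Ideal.sum_mem _ fun x hx => ?_
    refine ha.mem_of_isHomogeneous hy hX.isHomog hμ (isHomogeneous_monomial _ rfl) fun i => ?_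
    have h1 := hf x hx
    have h2 := Finset.le_sup (f := μ) (Finset.mem_univ i)
    omega
  have hQmap : (⊥ : Ideal (MvPolynomial (Fin (n + 1)) k ⧸ IX)) ⊔
      Ideal.ofList ((List.ofFn y).map π) = Q.map π := by
    rw [← Ideal.map_ofList, ofList_ofFn, hQ, Ideal.map_sup, Ideal.map_quotient_self]
  have htop : ExtSelf.CyclicTop (Q.map π) (0 + ((List.ofFn y).map π).length) := by
    rw [← hQmap]
    refine ExtSelf.cyclicTop_bot.of_regOn ?_
    have := hreg.map_quotient le_rfl
    rwa [Ideal.map_quotient_self] at this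
  have hfl : IsFiniteLength (MvPolynomial (Fin (n + 1)) k ⧸ IX)
      ((MvPolynomial (Fin (n + 1)) k ⧸ IX) ⧸ Q.map π) := by
    have := hX.finite_quotient hreg
    have hfin : Module.Finite k ((MvPolynomial (Fin (n + 1)) k ⧸ IX) ⧸ Q.map π) := by
      refine Module.Finite.of_surjective (Ideal.Quotient.liftₐ Q
        ((Ideal.Quotient.mkₐ k (Q.map π)).comp (Ideal.Quotient.mkₐ k IX)) ?_).toLinearMap ?_
      · intro x hx
        exact Ideal.Quotient.eq_zero_iff_mem.2 (Ideal.mem_map_of_mem π hx)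
      · intro x
        obtain ⟨x, rfl⟩ := Ideal.Quotient.mk_surjective x
        obtain ⟨x, rfl⟩ := hπ x
        exact ⟨Ideal.Quotient.mk Q x, rfl⟩
    rw [isFiniteLength_iff_isNoetherian_isArtinian]
    exact ⟨isNoetherian_of_tower k inferInstance, isArtinian_of_tower k inferInstance⟩
  have hQtop : Q.map π ≠ ⊤ := by
    intro h
    apply sup_span_ne_top hX hy
    rw [← hQ, Ideal.eq_top_iff_one, ← hmem _ hIXQ, h]
    trivial
  have hloc : ∀ 𝔫 : Ideal (MvPolynomial (Fin (n + 1)) k ⧸ IX), 𝔫.IsMaximal → Q.map π ≤ 𝔫 →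
      𝔫 = 𝔪.map π := by
    intro 𝔫 h𝔫 hle
    refine (hmax.eq_of_le h𝔫.ne_top ?_).symm
    rw [Ideal.map_le_iff_le_comap] at hle ⊢
    have := h𝔫.isPrime
    exact Ideal.IsPrime.le_of_pow_le (hpow.trans hle)
  have hsoc : ∀ u : MvPolynomial (Fin (n + 1)) k, (∀ w ∈ 𝔪, w * u ∈ Q) →
      ∀ x ∈ 𝔪.map π, x * π u ∈ Q.map π := by
    intro u hu x hx
    obtain ⟨x, rfl⟩ := hπ x
    rw [← map_mul, hmem _ hIXQ]
    exact hu x ((hmem _ hIXm x).1 hx)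
  obtain ⟨b, c, hbc, h⟩ := ProjACM.exists_mul_add_mul_mem hN hloc hQtop hfl htop
    (hsoc u hu) (hsoc v hv)
  obtain ⟨b, rfl⟩ := hπ b
  obtain ⟨c, rfl⟩ := hπ c
  rw [hmem _ hIXm, hmem _ hIXm] at hbc
  rw [← map_mul, ← map_mul, ← map_add, hmem _ hIXQ] at h
  exact ⟨b, c, hbc, h⟩

lemma exists_ofFn_eq {α : Type*} {l : List α} {p : ℕ} (h : l.length = p) :
    ∃ y : Fin p → α, List.ofFn y = l := by
  subst h
  exact ⟨l.get, List.ofFn_get l⟩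

/-- Linear forms which are simultaneously regular on `X` and on a hypersurface `Y` of `X`. -/
lemma exists_linear_system [Infinite k] {p : ℕ} (hX : IsACM (p + 1) IX) (hY : IsACM p IY) :
    ∃ (y : Fin (p + 1) → MvPolynomial (Fin (n + 1)) k) (x : MvPolynomial (Fin (n + 1)) k),
      (∀ i, (y i).IsHomogeneous 1) ∧ x.IsHomogeneous 1 ∧
      RegOn ⊤ IX (List.ofFn y ++ [x]) ∧ RegOn ⊤ IY (List.ofFn y) := by
  obtain ⟨rs, hrl, hrs, hrm⟩ := hX.exists_regOn
  obtain ⟨ts, htl, hts, htm⟩ := hY.exists_regOn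
  obtain ⟨ys, x, hyl, hys, hx, h1, h2⟩ := exists_linear_regOn hrs hrl hrm hts htl htm
  obtain ⟨y, rfl⟩ := exists_ofFn_eq hyl
  exact ⟨y, x, fun i => hys _ (List.mem_ofFn.2 ⟨i, rfl⟩), hx, h1, h2⟩

lemma ofFn_snoc {α : Type*} {p : ℕ} (y : Fin p → α) (x : α) :
    List.ofFn (Fin.snoc (α := fun _ => α) y x) = List.ofFn y ++ [x] := by
  rw [List.ofFn_succ', List.concat_eq_append]
  simp

lemma snoc_isHomogeneous {p : ℕ} {y : Fin p → MvPolynomial (Fin (n + 1)) k}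
    {x : MvPolynomial (Fin (n + 1)) k} (hy : ∀ i, (y i).IsHomogeneous 1) (hx : x.IsHomogeneous 1)
    (i : Fin (p + 1)) :
    (Fin.snoc (α := fun _ => MvPolynomial (Fin (n + 1)) k) y x i).IsHomogeneous 1 := by
  induction i using Fin.lastCases with
  | last => simpa using hx
  | cast i => simpa using hy i

/-- The ideal of a hypersurface of `X` contains a nonzerodivisor of `A_X`. -/
lemma exists_regular_mem [Infinite k] {p : ℕ} (hX : IsACM (p + 1) IX) (hY : IsACM p IY) :
    ∃ z ∈ IY, ∀ u, z * u ∈ IX → u ∈ IX := by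
  obtain ⟨y, x, hy, hx, hregX, hregY⟩ := exists_linear_system hX hY
  rw [← ofFn_snoc] at hregX
  obtain ⟨d, -, a, -, -, ha⟩ := hX.exists_isRelBasis_top (snoc_isHomogeneous hy hx) hregX
  obtain ⟨d', -, c, -, -, hc⟩ := hY.exists_isRelBasis_top hy hregY
  -- `S / IY` is finite over `k[y]`, so `y, x` satisfy a nontrivial relation `f` modulo `IY`; `S /
  -- IX` is free over `k[y, x]`, so the same `f(y, x)` is a nonzerodivisor there.
  obtain ⟨f, hf, hfY⟩ := hc.exists_aeval_snoc_mem x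
  exact ⟨_, hfY, ha.regular_aeval hf⟩

/-! ### Duality for linked hypersurfaces. -/

section Linked

variable {s : ℕ} {IY' : Ideal (MvPolynomial (Fin (n + 1)) k)} {h : MvPolynomial (Fin (n + 1)) k}

lemma mem_sup_span_singleton {x : MvPolynomial (Fin (n + 1)) k} :
    x ∈ IX ⊔ Ideal.span {h} ↔ ∃ q, x - h * q ∈ IX := by
  rw [Submodule.mem_sup]
  constructor
  · rintro ⟨i, hi, z, hz, rfl⟩
    obtain ⟨c, rfl⟩ := Ideal.mem_span_singleton.1 hz
    exact ⟨c, by simpa using hi⟩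
  · rintro ⟨c, hc⟩
    exact ⟨_, hc, h * c, Ideal.mul_mem_right _ _ (Ideal.mem_span_singleton_self h), by ring⟩

/-- Surjectivity of the link map makes `J` the whole colon ideal `K : I`: multiplication by `w` is
multiplication by some `f ∈ J`, and `w = f` by cancelling a nonzero element of `I`. -/
lemma AreLinked.mem_of_mul_le {S : Type*} [CommRing S] [IsDomain S] {I J K : Ideal S}
    (hlink : AreLinked I J K) (hI : I ≠ ⊥) {w : S} (hw : ∀ x ∈ I, w * x ∈ K) : w ∈ J := by
  let ψ : I →ₗ[S] K :=
    { toFun := fun x => ⟨w * x, hw x x.2⟩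
      map_add' := fun x y => Subtype.ext (mul_add _ _ _)
      map_smul' := fun r x => Subtype.ext (mul_left_comm _ _ _) }
  obtain ⟨f, hf⟩ := hlink.bijective.2 ψ
  obtain ⟨x, hx, hx0⟩ := Submodule.exists_mem_ne_zero_of_ne_bot hI
  have h1 : x * (f : S) = w * x := congrArg Subtype.val (LinearMap.congr_fun hf ⟨x, hx⟩)
  rw [mul_comm] at h1
  rw [← mul_right_cancel₀ hx0 h1]
  exact f.2

/-- The graded `k[y]`-duality between the ideals of linked hypersurfaces of `X`. -/
lemma AreLinked.exists_dual_basis [Infinite k] {p : ℕ} (hX : IsACM (p + 1) IX)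
    (hG : IsGorenstein IX) (hY : IsACM p IY) (hY' : IsACM p IY') (hXY' : IX ≤ IY')
    (hh : h.IsHomogeneous s) (hlink : AreLinked IY IY' (IX ⊔ Ideal.span {h}))
    {y : Fin (p + 2) → MvPolynomial (Fin (n + 1)) k} (hy : ∀ i, (y i).IsHomogeneous 1)
    (hreg : RegOn ⊤ IX (List.ofFn y)) {d d' : ℕ} {a : Fin d → MvPolynomial (Fin (n + 1)) k}
    (ha : IsRelBasis y ⊤ IX a) {μ : Fin d → ℕ} (hμ : ∀ i, (a i).IsHomogeneous (μ i)) {ℓ : Fin d}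
    (hℓ : ∀ i, μ i ≤ μ ℓ) {g : Fin d' → MvPolynomial (Fin (n + 1)) k}
    (hg : IsRelBasis y IY IX g) {ν : Fin d' → ℕ} (hν : ∀ i, (g i).IsHomogeneous (ν i)) :
    ∃ g' : Fin d' → MvPolynomial (Fin (n + 1)) k, IsRelBasis y IY' IX g' ∧
      ∀ i, ν i ≤ μ ℓ + s ∧ (g' i).IsHomogeneous (μ ℓ + s - ν i) := by
  obtain ⟨z, hzY, hz⟩ := exists_regular_mem hX hY
  obtain ⟨z', hzY', hz'⟩ := exists_regular_mem hX hY'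
  have hbot : IY ≠ ⊥ := by
    rintro rfl
    rw [Ideal.mem_bot] at hzY
    apply hX.ne_top
    rw [Ideal.eq_top_iff_one]
    exact hz 1 (by rw [hzY, zero_mul]; exact IX.zero_mem)
  have hmul : ∀ x ∈ IY, ∀ w ∈ IY', ∃ q, w * x - h * q ∈ IX := fun x hx w hw =>
    mem_sup_span_singleton.1 (hlink.mul_le (by rw [mul_comm w x]; exact Ideal.mul_mem_mul hx hw))
  refine IsRelBasis.exists_dual (ha.isPerfectForm hy hX.isHomog hμ hℓ
    (hX.exists_mul_add_mul_mem hG hy hreg ha hμ)) hy hX.isHomog hXY' hh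
    (hlink.left_le (le_sup_right (a := IX) (Ideal.mem_span_singleton_self h))) hmul
    (fun w hw => hlink.mem_of_mul_le hbot fun x hx => mem_sup_span_singleton.2 (hw x hx))
    (fun u hu => ?_) hzY hz hg hν
  -- The product `z' z` of nonzerodivisors is a multiple of `h` modulo `IX`, so `h` is a
  -- nonzerodivisor too.
  obtain ⟨q, hq⟩ := hmul z hzY z' hzY'
  refine hz _ (hz' _ ?_)
  have h1 : z' * (z * u) = (z' * z - h * q) * u + q * (h * u) := by ring
  rw [h1]
  exact IX.add_mem (IX.mul_mem_right _ hq) (IX.mul_mem_left _ hu)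

lemma monotone_sub_rev {d c : ℕ} {ν : Fin d → ℕ} (hν : Monotone ν) :
    Monotone fun i : Fin d => c - ν i.rev := fun _ _ hij =>
  Nat.sub_le_sub_left (hν (Fin.rev_le_rev.2 hij)) c

end Linked

end ACM

end ProjACM

/-! ### Existence of the characteristic sequences and the linkage formula. -/

open ProjACM in
theorem mainTheorem6 {k : Type*} [Field k] [IsAlgClosed k] [CharZero k]
    (n m s : ℕ) (hm : 1 ≤ m)
    (IX IY IY' : Ideal (MvPolynomial (Fin (n + 1)) k)) (h : MvPolynomial (Fin (n + 1)) k)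
    (hX : ProjACM.IsACM m IX) (hG : ProjACM.IsGorenstein IX)
    (hY : ProjACM.IsACM (m - 1) IY) (hXY : IX ≤ IY)
    (hY' : ProjACM.IsACM (m - 1) IY') (hXY' : IX ≤ IY')
    (hh : h.IsHomogeneous s)
    (hlink : ProjACM.AreLinked IY IY' (IX ⊔ Ideal.span {h})) :
    (∃ (d : ℕ) (μ ν ν' : Fin d → ℕ), ProjACM.IsCharSeq m IX μ ∧
      ProjACM.IsRelCharSeq m IX IY ν ∧ ProjACM.IsRelCharSeq m IX IY' ν') ∧
    ∀ (d : ℕ) (μ ν ν' : Fin d → ℕ), ProjACM.IsCharSeq m IX μ →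
      ProjACM.IsRelCharSeq m IX IY ν → ProjACM.IsRelCharSeq m IX IY' ν' →
      ∀ i : Fin d, ν i + ν' i.rev = μ ⟨d - 1, Nat.sub_one_lt_of_lt i.isLt⟩ + s := by
  obtain ⟨p, rfl⟩ : ∃ p, m = p + 1 := ⟨m - 1, by omega⟩
  rw [Nat.add_sub_cancel] at hY hY'
  have htopmap : (⊤ : Ideal (MvPolynomial (Fin (n + 1)) k)).map (Ideal.Quotient.mk IX) = ⊤ :=
    Ideal.map_top _
  refine ⟨?_, fun d μ ν ν' hμ hν hν' i => ?_⟩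
  · obtain ⟨y₀, x, hy₀, hx, hregX, hregY⟩ := exists_linear_system hX hY
    -- Since `IX ≤ IY`, the intersection and the sum of the two ideals are `IX` and `IY`, and
    -- regularity on both quotients gives regularity on `IY / IX`.
    have hregYX : RegOn IY IX (List.ofFn y₀ ++ [x]) := by
      have := hregX.inf (L := IY) (by rwa [sup_eq_right.2 hXY])
      rwa [inf_eq_left.2 hXY] at this
    rw [← ofFn_snoc] at hregX hregYX
    have hy := snoc_isHomogeneous hy₀ hx
    set y := Fin.snoc (α := fun _ => MvPolynomial (Fin (n + 1)) k) y₀ x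
    have hsys := (isRegularLinearSystem_iff hX).2 ⟨hy, hregX⟩
    obtain ⟨d, μ, a, hμmono, hμ, ha⟩ := hX.exists_isRelBasis_top hy hregX
    obtain ⟨d', ν, g, hνmono, hν, hg, -⟩ := exists_isRelBasis hy hY.isHomog hX.isHomog hregYX
      (ha.finite_generation hXY)
    obtain ⟨z, hzY, hz⟩ := exists_regular_mem hX hY
    -- Multiplication by `z ∈ IY` embeds `A_X` in `IY / IX`, and inclusion goes the other way, so
    -- the ranks agree.
    obtain rfl : d = d' := le_antisymm (ha.card_le hg (fun u _ => IY.mul_mem_right u hzY) hz)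
      (hg.card_le ha (z := 1) (fun _ _ => trivial) fun u hu => by rwa [one_mul] at hu)
    have hd : d ≠ 0 := by
      rintro rfl
      obtain ⟨f, hf⟩ := ha.span 1 trivial
      rw [comb, Finset.univ_eq_empty, Finset.sum_empty, sub_zero] at hf
      exact hX.ne_top ((Ideal.eq_top_iff_one _).2 hf)
    let ℓ : Fin d := ⟨d - 1, by omega⟩
    have hℓ : ∀ i, μ i ≤ μ ℓ := fun i => hμmono (Fin.le_def.2 (by have := i.2; simp only [ℓ]; omega))
    obtain ⟨g', hg', hν'⟩ := hlink.exists_dual_basis hX hG hY hY' hXY' hh hy hregX ha hμ hℓ hg hν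
    refine ⟨d, μ, ν, fun i => μ ℓ + s - ν i.rev, ⟨hμmono, y, hsys, ?_⟩, ⟨hνmono, y, hsys, ?_⟩,
      ⟨monotone_sub_rev hνmono, y, hsys, ?_⟩⟩
    · rw [← htopmap]
      exact ha.hasHomogeneousBasis hμ
    · exact hg.hasHomogeneousBasis hν
    · exact (hg'.reindex Fin.revPerm).hasHomogeneousBasis fun i => (hν' i.rev).2
  · have hinj : ∀ y : Fin (p + 2) → MvPolynomial (Fin (n + 1)) k, IsRegularLinearSystem IX y →
        ∀ f : MvPolynomial (Fin (p + 2)) k, MvPolynomial.aeval y f ∈ IX → f = 0 := by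
      intro y hy
      have h1 := (isRegularLinearSystem_iff hX).1 hy
      exact aeval_injective_of_regOn h1.2 (sup_span_ne_top hX h1.1)
    obtain ⟨hμmono, y₁, hy₁, hb₁⟩ := hμ
    obtain ⟨hνmono, y, hy, hb⟩ := hν
    obtain ⟨hν'mono, y₂, hy₂, hb₂⟩ := hν'
    rw [← htopmap] at hb₁
    obtain ⟨a₁, hμ₁, ha₁⟩ := hb₁.exists_isRelBasis le_top (hinj _ hy₁)
    obtain ⟨g, hν, hg⟩ := hb.exists_isRelBasis hXY (hinj _ hy)
    obtain ⟨g₂, hν', hg₂⟩ := hb₂.exists_isRelBasis hXY' (hinj _ hy₂)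
    obtain ⟨hylin, hyreg⟩ := (isRegularLinearSystem_iff hX).1 hy
    -- The duality needs `A_X` and `IY / IX` over the same linear forms. A basis of `A_X` is taken
    -- over those used for `ν`, and its degrees are again `μ` by Hilbert functions.
    obtain ⟨d', μ', a, hμ'mono, hμ, ha⟩ := hX.exists_isRelBasis_top hylin hyreg
    cases ha.sigma_eq ha₁ hylin hy₁.linear hX.isHomog hμ hμ₁ hμ'mono hμmono
    set ℓ : Fin d := ⟨d - 1, Nat.sub_one_lt_of_lt i.isLt⟩
    have hℓ : ∀ i, μ i ≤ μ ℓ := fun i => hμmono (Fin.le_def.2 (by have := i.2; simp only [ℓ]; omega))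
    obtain ⟨g', hg', hdeg⟩ := hlink.exists_dual_basis hX hG hY hY' hXY' hh hylin hyreg ha hμ hℓ hg hν
    -- The dual basis, reversed so that its degrees increase, is compared with the basis of `IY' /
    -- IX` over the third choice of linear forms.
    have heq := (hg'.reindex Fin.revPerm).sigma_eq hg₂ hylin hy₂.linear hX.isHomog
      (e := fun i => μ ℓ + s - ν i.rev) (fun i => (hdeg i.rev).2) hν' (monotone_sub_rev hνmono)
      hν'mono
    have hfun : (fun i : Fin d => μ ℓ + s - ν i.rev) = ν' := eq_of_heq (Sigma.mk.inj heq).2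
    rw [← hfun]
    change ν i + (μ ℓ + s - ν i.rev.rev) = μ ℓ + s
    rw [Fin.rev_rev]
    exact Nat.add_sub_of_le (hdeg i).1
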